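/- Let $\mathcal N=\{1,\dots,N\}$. A group structure $\mathfrak G=\{\mathcal G_1,\dots,\mathcal G_M\}$ on $\mathcal N$ is a collection of sets $\mathcal G_j\subseteq\mathcal N$ with $\bigcup_j\mathcal G_j=\mathcal N$; let $\mathbf A^{\mathfrak G}\in\{0,1\}^{N\times M}$ be the matrix with $A^{\mathfrak G}_{ij}=1$ if and only if $i\in\mathcal G_j$. Its group graph has the groups as nodes and an edge between two distinct groups $\mathcal G_j,\mathcal G_k$ whenever $\mathcal G_j\cap\mathcal G_k\neq\emptyset$. The group structure is called loopless pairwise overlapping if each $i\in\mathcal N$ belongs to at most two groups and the group graph contains no cycle. There exist a single algorithm (a program for a random access machine with exact real arithmetic, in which each arithmetic operation $+,-$ on integers, $+,-,\times$ on reals, each comparison and each memory access costs one unit of time) and a polynomial $p$ such that, for all $N,M$, every loopless pairwise overlapping group structure $\mathfrak G$ with $M$ groups on $\{1,\dots,N\}$, every integer $G\ge 0$ and every $\mathbf x\in\mathbb R^N$, the algorithm, given $N$, $M$, $G$, $\mathbf A^{\mathfrak G}$ and $\mathbf x$, halts after at most $p(N+M)$ steps and returns an optimal solution $(\boldsymbol\omega,\mathbf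 y)$ of the weighted maximum coverage problem $$\max_{\boldsymbol\omega\in\{0,1\}^M,\ \mathbf y\in\{0,1\}^N}\Big\{\sum_{i=1}^N y_i x_i^2\ :\ \mathbf A^{\mathfrak G}\boldsymbol\omega\ge\mathbf y,\ \sum_{j=1}^M\omega_j\le G\Big\}.$$ -/

import Mathlib

/-! ### Real RAM

A random access machine with exact real arithmetic.  The memory consists of arrays of natural
numbers and arrays of real numbers.  The only primitive operations are: on natural numbers,
constants, indirect loads, addition, truncated subtraction and comparison; on real numbers, natural
constants, loads, addition, subtraction, multiplication and comparison.  (There is no rounding and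
no multiplication of addresses, and no constant other than natural numbers, so that no
information can be hidden in constants or in long words.)  Each primitive operation costs one unit.
Control flow is structured: sequencing, conditionals and while loops. -/

namespace RealRAM

/-- Memory: `nat a i` and `real a i` are the cells of index `i` in the arrays named `a`. -/
structure Store where
  nat : ℕ → ℕ → ℕ
  real : ℕ → ℕ → ℝ

/-- Natural number expressions. The name of an array is fixed in the program, the index is
computed. -/
inductive NatExpr where
  | lit (n : ℕ)
  | load (a : ℕ) (i : NatExpr)
  | add (e₁ e₂ : NatExpr)
  | sub (e₁ e₂ : NatExpr)

namespace NatExpr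

def value (s : Store) : NatExpr → ℕ
  | lit n => n
  | load a i => s.nat a (i.value s)
  | add e₁ e₂ => e₁.value s + e₂.value s
  | sub e₁ e₂ => e₁.value s - e₂.value s

/-- The number of primitive operations in an expression. -/
def cost : NatExpr → ℕ
  | lit _ => 1
  | load _ i => i.cost + 1
  | add e₁ e₂ => e₁.cost + e₂.cost + 1
  | sub e₁ e₂ => e₁.cost + e₂.cost + 1

end NatExpr

/-- Real number expressions. -/
inductive RealExpr where
  | lit (n : ℕ)
  | load (a : ℕ) (i : NatExpr)
  | add (e₁ e₂ : RealExpr)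
  | sub (e₁ e₂ : RealExpr)
  | mul (e₁ e₂ : RealExpr)

namespace RealExpr

noncomputable def value (s : Store) : RealExpr → ℝ
  | lit n => (n : ℝ)
  | load a i => s.real a (i.value s)
  | add e₁ e₂ => e₁.value s + e₂.value s
  | sub e₁ e₂ => e₁.value s - e₂.value s
  | mul e₁ e₂ => e₁.value s * e₂.value s

def cost : RealExpr → ℕ
  | lit _ => 1
  | load _ i => i.cost + 1
  | add e₁ e₂ => e₁.cost + e₂.cost + 1
  | sub e₁ e₂ => e₁.cost + e₂.cost + 1
  | mul e₁ e₂ => e₁.cost + e₂.cost + 1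

end RealExpr

/-- Tests: comparisons of natural numbers or of real numbers, and their Boolean combinations. -/
inductive Test where
  | natLe (e₁ e₂ : NatExpr)
  | realLe (e₁ e₂ : RealExpr)
  | not (b : Test)
  | and (b₁ b₂ : Test)

namespace Test

def Holds (s : Store) : Test → Prop
  | natLe e₁ e₂ => e₁.value s ≤ e₂.value s
  | realLe e₁ e₂ => e₁.value s ≤ e₂.value s
  | not b => ¬ b.Holds s
  | and b₁ b₂ => b₁.Holds s ∧ b₂.Holds s

def cost : Test → ℕ
  | natLe e₁ e₂ => e₁.cost + e₂.cost + 1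
  | realLe e₁ e₂ => e₁.cost + e₂.cost + 1
  | not b => b.cost + 1
  | and b₁ b₂ => b₁.cost + b₂.cost + 1

end Test

/-- Programs. `setNat a i e` and `setReal a i e` store the value of `e` in cell `i` of array `a`;
`loop b c` repeats `c` as long as `b` holds. -/
inductive Program where
  | skip
  | setNat (a : ℕ) (i e : NatExpr)
  | setReal (a : ℕ) (i : NatExpr) (e : RealExpr)
  | seq (c₁ c₂ : Program)
  | ite (b : Test) (c₁ c₂ : Program)
  | loop (b : Test) (c : Program)

def Store.setNat (s : Store) (a i v : ℕ) : Store :=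
  { s with nat := Function.update s.nat a (Function.update (s.nat a) i v) }

noncomputable def Store.setReal (s : Store) (a i : ℕ) (v : ℝ) : Store :=
  { s with real := Function.update s.real a (Function.update (s.real a) i v) }

/-- `Runs c s s' t`: started in the store `s`, the program `c` halts in the store `s'` after
exactly `t` steps. -/
inductive Runs : Program → Store → Store → ℕ → Prop
  | skip (s : Store) : Runs .skip s s 1
  | setNat (s : Store) (a : ℕ) (i e : NatExpr) :
      Runs (.setNat a i e) s (s.setNat a (i.value s) (e.value s)) (i.cost + e.cost + 1)
  | setReal (s : Store) (a : ℕ) (i : NatExpr) (e : RealExpr) :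
      Runs (.setReal a i e) s (s.setReal a (i.value s) (e.value s)) (i.cost + e.cost + 1)
  | seq {c₁ c₂ : Program} {s s' s'' : Store} {t₁ t₂ : ℕ} :
      Runs c₁ s s' t₁ → Runs c₂ s' s'' t₂ → Runs (.seq c₁ c₂) s s'' (t₁ + t₂)
  | iteTrue {b : Test} {c₁ c₂ : Program} {s s' : Store} {t : ℕ} :
      b.Holds s → Runs c₁ s s' t → Runs (.ite b c₁ c₂) s s' (b.cost + t + 1)
  | iteFalse {b : Test} {c₁ c₂ : Program} {s s' : Store} {t : ℕ} :
      ¬ b.Holds s → Runs c₂ s s' t → Runs (.ite b c₁ c₂) s s' (b.cost + t + 1)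
  | loopDone {b : Test} {c : Program} {s : Store} :
      ¬ b.Holds s → Runs (.loop b c) s s (b.cost + 1)
  | loopStep {b : Test} {c : Program} {s s' s'' : Store} {t₁ t₂ : ℕ} :
      b.Holds s → Runs c s s' t₁ → Runs (.loop b c) s' s'' t₂ →
        Runs (.loop b c) s s'' (b.cost + 1 + t₁ + t₂)

end RealRAM

/-! ### Group structures -/

/-- A group structure with `M` groups over the ground set `Fin N`. -/
structure GroupStructure (N M : ℕ) where
  group : Fin M → Finset (Fin N)
  cover : ∀ i : Fin N, ∃ j : Fin M, i ∈ group j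

namespace GroupStructure

variable {N M : ℕ}

/-- The variables-groups bi-adjacency matrix. -/
def biadj (𝔊 : GroupStructure N M) : Matrix (Fin N) (Fin M) ℕ :=
  Matrix.of fun i j => if i ∈ 𝔊.group j then 1 else 0

/-- The group graph: the nodes are the groups, edges connect distinct groups that overlap. -/
def groupGraph (𝔊 : GroupStructure N M) : SimpleGraph (Fin M) where
  Adj j k := j ≠ k ∧ (𝔊.group j ∩ 𝔊.group k).Nonempty
  symm := ⟨fun _ _ h => ⟨h.1.symm, by rw [Finset.inter_comm]; exact h.2⟩⟩
  loopless := ⟨fun _ h => h.1 rfl⟩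

/-- Each index lies in at most two groups and the group graph has no cycle. -/
def LooplessPairwiseOverlapping (𝔊 : GroupStructure N M) : Prop :=
  (∀ i : Fin N, (Finset.univ.filter fun j : Fin M => i ∈ 𝔊.group j).card ≤ 2) ∧
    𝔊.groupGraph.IsAcyclic

end GroupStructure

/-! ### The weighted maximum coverage problem -/

namespace WMC

variable {N M : ℕ}

/-- A feasible pair: binary vectors `ω` (selected groups) and `y` (selected variables) with
`A ω ≥ y` and `∑ ω_j ≤ G`. -/
def Feasible (𝔊 : GroupStructure N M) (G : ℕ) (ω : Fin M → ℕ) (y : Fin N → ℕ) : Prop :=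
  (∀ j, ω j = 0 ∨ ω j = 1) ∧ (∀ i, y i = 0 ∨ y i = 1) ∧
    (∀ i, y i ≤ (𝔊.biadj.mulVec ω) i) ∧ ∑ j, ω j ≤ G

noncomputable def objective (x : Fin N → ℝ) (y : Fin N → ℕ) : ℝ :=
  ∑ i, (y i : ℝ) * x i ^ 2

/-- `(ω, y)` is an optimal solution. -/
def IsSolution (𝔊 : GroupStructure N M) (G : ℕ) (x : Fin N → ℝ)
    (ω : Fin M → ℕ) (y : Fin N → ℕ) : Prop :=
  Feasible 𝔊 G ω y ∧
    ∀ (ω' : Fin M → ℕ) (y' : Fin N → ℕ), Feasible 𝔊 G ω' y' → objective x y' ≤ objective x y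

/-- The initial memory for an instance. The natural number array `0` holds `N, M, G`, the array `1`
holds the bi-adjacency matrix row by row (entry `(i, j)` in cell `i * M + j`), the real array `0`
holds the signal `x`; all other cells are `0`. -/
noncomputable def input (𝔊 : GroupStructure N M) (G : ℕ) (x : Fin N → ℝ) : RealRAM.Store where
  nat a k :=
    match a with
    | 0 => match k with
      | 0 => N
      | 1 => M
      | 2 => G
      | _ => 0
    | 1 => if h : k < N * M then 𝔊.biadj (Fin.divNat ⟨k, h⟩) (Fin.modNat ⟨k, h⟩) else 0
    | _ => 0
  real a k :=
    match a with
    | 0 => if h : k < N then x ⟨k, h⟩ else 0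
    | _ => 0

/-- The output vector `ω` is read from the natural number array `2`. -/
def outputGroups (M : ℕ) (s : RealRAM.Store) : Fin M → ℕ := fun j => s.nat 2 j

/-- The output vector `y` is read from the natural number array `3`. -/
def outputVariables (N : ℕ) (s : RealRAM.Store) : Fin N → ℕ := fun i => s.nat 3 i

end WMC

/-!
The algorithm builds up a partition of the groups into blocks, each with a root, such that blocks
meet only through their roots. At the start the blocks are the single groups. As long as at least
two roots are left, the acyclic group graph has, on the roots, a leaf: a root that meets at most one
other root. Its block is merged into the block of that neighbour, or into any other block if there
is no neighbour.

For each block, for each size, and for each choice of whether the root is taken, the algorithm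
stores a best set of at most that many nonroot groups of the block. Two blocks overlap only where
both roots are taken, so for fixed choices at the two roots the coverage of a union of sets from the
blocks is the sum of the two coverages minus a constant. Hence the best set for a merged block is a
union of best sets for its parts.

The programs use only loops with `N` or `M` iterations, so their running time is bounded by a
polynomial that can be read off from their syntax.
-/

namespace RealRAM

attribute [simp] NatExpr.value RealExpr.value Test.Holds

@[simp]
theorem nat_setNat (s : Store) (a i v b j : ℕ) :
    (s.setNat a i v).nat b j = if b = a ∧ j = i then v else s.nat b j := by
  by_cases h : b = a
  · subst h
    simp [Store.setNat, Function.update_apply]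
  · simp [Store.setNat, h]

theorem nat_setNat_of_ne (s : Store) {a b : ℕ} (i v : ℕ) (h : b ≠ a) :
    (s.setNat a i v).nat b = s.nat b := by
  simp [Store.setNat, h]

@[simp]
theorem nat_setReal (s : Store) (a i : ℕ) (v : ℝ) : (s.setReal a i v).nat = s.nat := rfl

@[simp]
theorem real_setReal_self (s : Store) (a i : ℕ) (v : ℝ) : (s.setReal a i v).real a i = v := by
  simp [Store.setReal]

theorem real_setReal_of_ne (s : Store) {a b : ℕ} (i : ℕ) (v : ℝ) (h : b ≠ a) :
    (s.setReal a i v).real b = s.real b := by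
  simp [Store.setReal, h]

/-- The cell `0` of an array, used as a register. -/
abbrev reg (k : ℕ) : NatExpr := .load k (.lit 0)

/-- Programs all of whose loops are counted. `forLoop k n c` repeats `c` as often as the cell `n` of
the array `0` says: `N` times for `n = 0` and `M` times for `n = 1` in the input of `WMC.input`. The
register `k` holds the number of completed iterations. -/
inductive ForProgram where
  | skip
  | setNat (a : ℕ) (i e : NatExpr)
  | setReal (a : ℕ) (i : NatExpr) (e : RealExpr)
  | seq (c₁ c₂ : ForProgram)
  | ite (b : Test) (c₁ c₂ : ForProgram)
  | forLoop (k : ℕ) (n : Fin 2) (c : ForProgram)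

namespace ForProgram

/-- The translation of a counted program into a program of the machine. -/
def compile : ForProgram → Program
  | skip => .skip
  | setNat a i e => .setNat a i e
  | setReal a i e => .setReal a i e
  | seq c₁ c₂ => .seq c₁.compile c₂.compile
  | ite b c₁ c₂ => .ite b c₁.compile c₂.compile
  | forLoop k n c =>
      .seq (.setNat k (.lit 0) (.lit 0))
        (.loop (.natLe (.add (reg k) (.lit 1)) (.load 0 (.lit n)))
          (.seq c.compile (.setNat k (.lit 0) (.add (reg k) (.lit 1)))))

/-- The arrays of natural numbers that a program may change. -/
def natWrites : ForProgram → List ℕ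
  | skip => []
  | setNat a _ _ => [a]
  | setReal _ _ _ => []
  | seq c₁ c₂ => c₁.natWrites ++ c₂.natWrites
  | ite _ c₁ c₂ => c₁.natWrites ++ c₂.natWrites
  | forLoop k _ c => k :: c.natWrites

/-- The arrays of real numbers that a program may change. -/
def realWrites : ForProgram → List ℕ
  | skip => []
  | setNat _ _ _ => []
  | setReal a _ _ => [a]
  | seq c₁ c₂ => c₁.realWrites ++ c₂.realWrites
  | ite _ c₁ c₂ => c₁.realWrites ++ c₂.realWrites
  | forLoop _ _ c => c.realWrites

/-- No loop body changes the register that counts its iterations. -/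
def WellFormed : ForProgram → Bool
  | skip => true
  | setNat _ _ _ => true
  | setReal _ _ _ => true
  | seq c₁ c₂ => c₁.WellFormed && c₂.WellFormed
  | ite _ c₁ c₂ => c₁.WellFormed && c₂.WellFormed
  | forLoop k _ c => c.WellFormed && decide (k ∉ c.natWrites)

/-- A bound for the running time in terms of a bound for the number of iterations of each loop. -/
noncomputable def timeBound : ForProgram → Polynomial ℕ
  | skip => 1
  | setNat _ i e => .C (i.cost + e.cost + 1)
  | setReal _ i e => .C (i.cost + e.cost + 1)
  | seq c₁ c₂ => c₁.timeBound + c₂.timeBound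
  | ite b c₁ c₂ => .C (b.cost + 1) + c₁.timeBound + c₂.timeBound
  | forLoop _ _ c => .X * (c.timeBound + .C 15) + .C 15

/-- The store after `m` iterations of a loop with counter `k` and body `f`. -/
def iterate (k : ℕ) (f : Store → Store) (s : Store) : ℕ → Store
  | 0 => s.setNat k 0 0
  | m + 1 => (f (iterate k f s m)).setNat k 0 (m + 1)

open Classical in
/-- The store in which a program halts. -/
noncomputable def eval : ForProgram → Store → Store
  | skip, s => s
  | setNat a i e, s => s.setNat a (i.value s) (e.value s)
  | setReal a i e, s => s.setReal a (i.value s) (e.value s)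
  | seq c₁ c₂, s => c₂.eval (c₁.eval s)
  | ite b c₁ c₂, s => if b.Holds s then c₁.eval s else c₂.eval s
  | forLoop k n c, s => iterate k c.eval s (s.nat 0 n)

attribute [simp] natWrites realWrites eval

/-- The stores `s` and `s'` agree on all arrays that `c` does not change. -/
structure Frame (c : ForProgram) (s s' : Store) : Prop where
  nat : ∀ {a}, a ∉ c.natWrites → s'.nat a = s.nat a
  real : ∀ {a}, a ∉ c.realWrites → s'.real a = s.real a

theorem Frame.seq {c₁ c₂ : ForProgram} {s s' s'' : Store} (h₁ : Frame c₁ s s')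
    (h₂ : Frame c₂ s' s'') : Frame (c₁.seq c₂) s s'' := by
  constructor
  · intro a ha
    simp only [natWrites, List.mem_append, not_or] at ha
    exact (h₂.nat ha.2).trans (h₁.nat ha.1)
  · intro a ha
    simp only [realWrites, List.mem_append, not_or] at ha
    exact (h₂.real ha.2).trans (h₁.real ha.1)

theorem Frame.iterate {c : ForProgram} (hc : ∀ s, Frame c s (c.eval s)) (k : ℕ) (n : Fin 2)
    (s : Store) (m : ℕ) : Frame (forLoop k n c) s (iterate k c.eval s m) := by
  induction m with
  | zero => exact ⟨fun h => nat_setNat_of_ne _ _ _ (List.ne_of_not_mem_cons h), fun _ => rfl⟩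
  | succ m ih =>
    refine ⟨fun h => ?_, fun h => ((hc _).real h).trans (ih.real h)⟩
    exact (nat_setNat_of_ne _ _ _ (List.ne_of_not_mem_cons h)).trans
      (((hc _).nat (List.not_mem_of_not_mem_cons h)).trans (ih.nat h))

theorem frame_eval (c : ForProgram) (s : Store) : Frame c s (c.eval s) := by
  induction c generalizing s with
  | skip => exact ⟨fun _ => rfl, fun _ => rfl⟩
  | setNat b i e => exact ⟨fun h => nat_setNat_of_ne _ _ _ (by simpa using h), fun _ => rfl⟩
  | setReal b i e => exact ⟨fun _ => rfl, fun h => real_setReal_of_ne _ _ _ (by simpa using h)⟩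
  | seq c₁ c₂ h₁ h₂ => exact (h₁ _).seq (h₂ _)
  | ite b c₁ c₂ h₁ h₂ =>
    simp only [eval]
    constructor <;> intro a ha <;>
      simp only [natWrites, realWrites, List.mem_append, not_or] at ha <;> split_ifs
    exacts [(h₁ _).nat ha.1, (h₂ _).nat ha.2, (h₁ _).real ha.1, (h₂ _).real ha.2]
  | forLoop k n c hc => exact .iterate hc k n s _

@[simp]
theorem iterate_nat_counter (k : ℕ) (f : Store → Store) (s : Store) (m : ℕ) :
    (iterate k f s m).nat k 0 = m := by
  cases m <;> simp [iterate]

theorem eval_seq (c₁ c₂ : ForProgram) (s : Store) : (seq c₁ c₂).eval s = c₂.eval (c₁.eval s) := rfl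

/-- In the inductive step, everything that the loop does not change is available from the store at
its start. -/
theorem eval_forLoop_induction {k m : ℕ} {n : Fin 2} {c : ForProgram} {s : Store}
    (P : ℕ → Store → Prop) (hn : s.nat 0 n = m)
    (hcounter : ∀ i s' v, P i s' → P i (s'.setNat k 0 v)) (h0 : P 0 s)
    (hstep : ∀ i < m, ∀ s', Frame (forLoop k n c) s s' → s'.nat k 0 = i → P i s' →
      P (i + 1) (c.eval s')) :
    P m ((forLoop k n c).eval s) := by
  suffices ∀ i ≤ m, P i (iterate k c.eval s i) by rw [eval, hn]; exact this m le_rfl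
  intro i hi
  induction i with
  | zero => exact hcounter _ _ _ h0
  | succ i ih =>
    exact hcounter _ _ _ (hstep i hi _ (.iterate (frame_eval c) k n s i)
      (iterate_nat_counter k _ s i) (ih (by omega)))

theorem runs_compile_loop {k : ℕ} {n : Fin 2} {c : ForProgram} {s : Store} {t : ℕ}
    (hk : k ∉ c.natWrites) (h0 : 0 ∉ (forLoop k n c).natWrites)
    (hbody : ∀ m, ∃ t' ≤ t, Runs c.compile (iterate k c.eval s m)
      (c.eval (iterate k c.eval s m)) t') {d m : ℕ} (hd : m + d = s.nat 0 n) :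
    ∃ t' ≤ d * (t + 15) + 12, Runs (.loop (.natLe (.add (reg k) (.lit 1)) (.load 0 (.lit n)))
      (.seq c.compile (.setNat k (.lit 0) (.add (reg k) (.lit 1)))))
      (iterate k c.eval s m) (iterate k c.eval s (s.nat 0 n)) t' := by
  have hbound (m : ℕ) : (iterate k c.eval s m).nat 0 = s.nat 0 :=
    (Frame.iterate (frame_eval c) k n s m).nat h0
  induction d generalizing m with
  | zero =>
    obtain rfl : m = s.nat 0 n := hd
    exact ⟨_, by simp [Test.cost, NatExpr.cost], .loopDone (by simp [hbound])⟩
  | succ d ih =>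
    obtain ⟨t₁, ht₁, r₁⟩ := hbody m
    obtain ⟨t₂, ht₂, r₂⟩ := ih (m := m + 1) (by omega)
    have hstep : (c.eval (iterate k c.eval s m)).nat k 0 = m := by
      rw [(frame_eval c _).nat hk, iterate_nat_counter]
    refine ⟨_, ?_, .loopStep ?_ (.seq r₁ (.setNat _ _ _ _)) (by
      simpa only [iterate, NatExpr.value, hstep] using r₂)⟩
    · simp only [Test.cost, NatExpr.cost, add_one_mul]
      omega
    · simp only [Test.Holds, NatExpr.value, iterate_nat_counter, hbound]
      omega

theorem runs_compile (c : ForProgram) (s : Store) {B : ℕ} (hw : c.WellFormed)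
    (h0 : 0 ∉ c.natWrites) (hB : ∀ n : Fin 2, s.nat 0 n ≤ B) :
    ∃ t ≤ c.timeBound.eval B, Runs c.compile s (c.eval s) t := by
  induction c generalizing s with
  | skip => exact ⟨1, by simp [timeBound], .skip s⟩
  | setNat a i e => exact ⟨_, by simp [timeBound], .setNat s a i e⟩
  | setReal a i e => exact ⟨_, by simp [timeBound], .setReal s a i e⟩
  | seq c₁ c₂ h₁ h₂ =>
    simp only [natWrites, List.mem_append, not_or] at h0
    simp only [WellFormed, Bool.and_eq_true] at hw
    obtain ⟨t₁, ht₁, r₁⟩ := h₁ s hw.1 h0.1 hB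
    obtain ⟨t₂, ht₂, r₂⟩ := h₂ (c₁.eval s) hw.2 h0.2 (by rwa [(frame_eval c₁ s).nat h0.1])
    exact ⟨t₁ + t₂, by simp only [timeBound, Polynomial.eval_add]; omega, .seq r₁ r₂⟩
  | ite b c₁ c₂ h₁ h₂ =>
    simp only [natWrites, List.mem_append, not_or] at h0
    simp only [WellFormed, Bool.and_eq_true] at hw
    obtain ⟨t₁, ht₁, r₁⟩ := h₁ s hw.1 h0.1 hB
    obtain ⟨t₂, ht₂, r₂⟩ := h₂ s hw.2 h0.2 hB
    simp only [timeBound, eval, Polynomial.eval_add, Polynomial.eval_C]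
    split_ifs with hb
    · exact ⟨b.cost + t₁ + 1, by omega, .iteTrue hb r₁⟩
    · exact ⟨b.cost + t₂ + 1, by omega, .iteFalse hb r₂⟩
  | forLoop k n c hc =>
    simp only [WellFormed, Bool.and_eq_true, decide_eq_true_eq] at hw
    have hbody (m : ℕ) := hc (iterate k c.eval s m) hw.1 (List.not_mem_of_not_mem_cons h0)
      (by rwa [(Frame.iterate (frame_eval c) k n s m).nat h0])
    obtain ⟨t, ht, r⟩ := runs_compile_loop hw.2 h0 hbody (zero_add (s.nat 0 n))
    refine ⟨_, ?_, .seq (.setNat _ _ _ _) r⟩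
    simp only [NatExpr.cost, timeBound, Polynomial.eval_add, Polynomial.eval_mul,
      Polynomial.eval_X, Polynomial.eval_C]
    have := Nat.mul_le_mul_right (c.timeBound.eval B + 15) (hB n)
    omega

end ForProgram

end RealRAM

namespace WMC

theorem exists_leaf_of_isAcyclic {V : Type*} {G : SimpleGraph V} (hG : G.IsAcyclic)
    {R : Finset V} (hR : 1 < R.card) :
    ∃ v ∈ R, ∃ u ∈ R, v ≠ u ∧ ∀ w ∈ R, w ≠ v → w ≠ u → ¬ G.Adj v w := by
  classical
  let H := G.induce (R : Set V)
  have hne : Nonempty (R : Set V) := (Finset.card_pos.mp (by omega)).to_subtype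
  -- The first node `a` of a longest path has no neighbour besides the second node of that path.
  obtain ⟨a, z, p, hp, hmax⟩ := SimpleGraph.Walk.exists_isPath_forall_isPath_length_le_length H
  have mem_support {w} (hadj : H.Adj a w) : w ∈ p.support := by
    by_contra hw
    have := hmax _ _ (.cons hadj.symm p) ((SimpleGraph.Walk.cons_isPath_iff _ _).mpr ⟨hp, hw⟩)
    simp only [SimpleGraph.Walk.length_cons] at this
    omega
  by_cases hnil : p.Nil
  · obtain ⟨b, hb, hba⟩ := Finset.exists_mem_ne hR (a : V)
    refine ⟨a, a.2, b, hb, hba.symm, fun w hw hwa _ hadj => hwa ?_⟩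
    have := mem_support (w := ⟨w, hw⟩) hadj
    rw [SimpleGraph.Walk.nil_iff_support_eq.mp hnil, List.mem_singleton] at this
    exact congrArg Subtype.val this
  · refine ⟨a, a.2, p.snd, p.snd.2, fun h => (p.adj_snd hnil).ne (Subtype.ext h),
      fun w hw _ hwu hadj => hwu ?_⟩
    have hadj' : H.Adj a ⟨w, hw⟩ := hadj
    exact congrArg Subtype.val ((hG.induce _).eq_snd_of_adj_start hp hadj' (mem_support hadj'))

section Best

variable {σ β : Type*}

/-- `S` maximizes `f` over `𝒜`. In contrast to `IsMaxOn`, `S` has to belong to `𝒜`. -/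
structure IsBest [LE β] (f : σ → β) (𝒜 : Set σ) (S : σ) : Prop where
  mem : S ∈ 𝒜
  le : ∀ T ∈ 𝒜, f T ≤ f S

variable [LinearOrder β] {f : σ → β} {𝒜 ℬ : Set σ} {S T : σ}

/-- The one of `S` and `T` with the larger value of `f`, and `S` in case of a tie. -/
def better (f : σ → β) (S T : σ) : σ :=
  if f S < f T then T else S

theorem better_eq_or : better f S T = S ∨ better f S T = T := by
  unfold better
  split_ifs <;> simp

theorem le_better_left : f S ≤ f (better f S T) := by
  unfold better
  split_ifs with h
  exacts [h.le, le_rfl]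

theorem le_better_right : f T ≤ f (better f S T) := by
  unfold better
  split_ifs with h
  exacts [le_rfl, not_lt.mp h]

theorem IsBest.better (hS : IsBest f 𝒜 S) (hT : IsBest f ℬ T) :
    IsBest f (𝒜 ∪ ℬ) (better f S T) := by
  refine ⟨?_, ?_⟩
  · rcases better_eq_or (f := f) (S := S) (T := T) with h | h <;> rw [h]
    exacts [.inl hS.mem, .inr hT.mem]
  · rintro U (hU | hU)
    exacts [(hS.le U hU).trans le_better_left, (hT.le U hU).trans le_better_right]

end Best

section Coverage

variable {ι α β : Type*} [DecidableEq ι]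

/-- The total weight of the points in the union of the sets `A a`, `a ∈ S`. -/
def coverage [DecidableEq α] [AddCommMonoid β] (A : ι → Finset α) (x : α → β) (S : Finset ι) : β :=
  ∑ i ∈ S.biUnion A, x i

/-- The sets `S ⊆ D` that contain the root `u` if and only if `b` is `true`, and at most `g` other
elements. The root is not counted, so that these classes are never empty if `u ∈ D`. -/
def rooted (D : Finset ι) (u : ι) (b : Bool) (g : ℕ) : Set (Finset ι) :=
  {S | S ⊆ D ∧ (u ∈ S ↔ b = true) ∧ (S.erase u).card ≤ g}

theorem mem_rooted_singleton {u : ι} {b : Bool} {g : ℕ} {S : Finset ι} :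
    S ∈ rooted {u} u b g ↔ S = if b then {u} else ∅ := by
  simp only [rooted, Set.mem_ofPred_eq, Finset.subset_singleton_iff]
  constructor
  · rintro ⟨rfl | rfl, hb, -⟩ <;> simp_all
  · rintro rfl
    cases b <;> simp

/-- Two disjoint index sets `D` and `E` such that a set of the family `A` with index in `D` meets a
set with index in `E` only at the indices `u` and `v`. -/
structure MeetAtRoots (A : ι → Finset α) (D E : Finset ι) (u v : ι) : Prop where
  left_mem : u ∈ D
  right_mem : v ∈ E
  disjoint : Disjoint D E
  eq_roots : ∀ a ∈ D, ∀ b ∈ E, ¬ Disjoint (A a) (A b) → a = u ∧ b = v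

variable {A : ι → Finset α} {D E : Finset ι} {u v : ι}

omit [DecidableEq ι] in
theorem MeetAtRoots.ne (h : MeetAtRoots A D E u v) : v ≠ u :=
  (h.disjoint.forall_ne_finset h.left_mem h.right_mem).symm

theorem MeetAtRoots.biUnion_inter_biUnion [DecidableEq α] (h : MeetAtRoots A D E u v)
    {S T : Finset ι} (hS : S ⊆ D) (hT : T ⊆ E) :
    S.biUnion A ∩ T.biUnion A = if u ∈ S ∧ v ∈ T then A u ∩ A v else ∅ := by
  ext i
  rw [Finset.mem_inter, Finset.mem_biUnion, Finset.mem_biUnion]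
  constructor
  · rintro ⟨⟨a, ha, hia⟩, b, hb, hib⟩
    obtain ⟨rfl, rfl⟩ := h.eq_roots a (hS ha) b (hT hb) (Finset.not_disjoint_iff.mpr ⟨i, hia, hib⟩)
    rw [if_pos ⟨ha, hb⟩]
    exact Finset.mem_inter.mpr ⟨hia, hib⟩
  · split_ifs with huv
    · intro hi
      exact ⟨⟨u, huv.1, (Finset.mem_inter.mp hi).1⟩, v, huv.2, (Finset.mem_inter.mp hi).2⟩
    · intro hi
      simp at hi

theorem MeetAtRoots.isBest_union [DecidableEq α] [AddCommMonoid β] [PartialOrder β]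
    [IsOrderedCancelAddMonoid β] {x : α → β} (h : MeetAtRoots A D E u v) {S T : Finset ι}
    {b b' : Bool} {g g' : ℕ} (hS : IsBest (coverage A x) (rooted D u b g) S)
    (hT : IsBest (coverage A x) (rooted E v b' g') T) :
    IsBest (coverage A x) (Set.image2 (· ∪ ·) (rooted D u b g) (rooted E v b' g')) (S ∪ T) := by
  refine ⟨Set.mem_image2_of_mem hS.mem hT.mem, ?_⟩
  -- The overlap is the same for all members of the class, since it depends on `b` and `b'` only.
  have coverage_union {S T : Finset ι} (hS : S ∈ rooted D u b g) (hT : T ∈ rooted E v b' g') :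
      coverage A x (S ∪ T) + ∑ i ∈ if b ∧ b' then A u ∩ A v else ∅, x i =
        coverage A x S + coverage A x T := by
    rw [← if_congr (and_congr hS.2.1 hT.2.1) rfl rfl, ← h.biUnion_inter_biUnion hS.1 hT.1,
      coverage, Finset.union_biUnion, Finset.sum_union_inter]
    rfl
  rintro _ ⟨S', hS', T', hT', rfl⟩
  refine le_of_add_le_add_right (a := ∑ i ∈ if b ∧ b' then A u ∩ A v else ∅, x i) ?_
  rw [coverage_union hS.mem hT.mem, coverage_union hS' hT']
  exact add_le_add (hS.le S' hS') (hT.le T' hT')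

/-- The members of `rooted (D ∪ E) u b g` that have, for some `i < h`, at most `i + 1` elements
in `E` (the root `v` of `E` being one of them if `b'` is `true`) and at most `g - (i + 1)` elements
other than `u` in `D`, together with `rooted D u b g`. -/
def grafted (D E : Finset ι) (u v : ι) (b : Bool) (g h : ℕ) : Set (Finset ι) :=
  rooted D u b g ∪ {S | ∃ i < h, i < g ∧ ∃ b' : Bool,
    S ∈ Set.image2 (· ∪ ·) (rooted D u b (g - (i + 1))) (rooted E v b' (i + 1 - b'.toNat))}

theorem grafted_zero (b : Bool) (g : ℕ) : grafted D E u v b g 0 = rooted D u b g := by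
  simp [grafted]

theorem grafted_succ {g h : ℕ} (b : Bool) (hg : h < g) :
    grafted D E u v b g (h + 1) = grafted D E u v b g h ∪
      Set.image2 (· ∪ ·) (rooted D u b (g - (h + 1))) (rooted E v false (h + 1)) ∪
      Set.image2 (· ∪ ·) (rooted D u b (g - (h + 1))) (rooted E v true h) := by
  ext S
  simp only [grafted, Set.mem_union, Set.mem_ofPred_eq, Nat.lt_add_one_iff_lt_or_eq, or_and_right,
    exists_or, exists_eq_left, or_assoc, Bool.exists_bool, Bool.toNat_false, Bool.toNat_true, hg,
    true_and, Nat.sub_zero, Nat.add_sub_cancel]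

theorem grafted_succ_of_le {g h : ℕ} (b : Bool) (hg : g ≤ h) :
    grafted D E u v b g (h + 1) = grafted D E u v b g h := by
  have (i : ℕ) : i < h + 1 ∧ i < g ↔ i < h ∧ i < g := by omega
  simp only [grafted, ← and_assoc, this]

theorem MeetAtRoots.union_mem_rooted (h : MeetAtRoots A D E u v) {b b' : Bool} {g i : ℕ}
    {S T : Finset ι} (hi : i < g) (hS : S ∈ rooted D u b (g - (i + 1)))
    (hT : T ∈ rooted E v b' (i + 1 - b'.toNat)) : S ∪ T ∈ rooted (D ∪ E) u b g := by
  have huT : u ∉ T := fun hu => Finset.disjoint_left.mp h.disjoint h.left_mem (hT.1 hu)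
  refine ⟨Finset.union_subset_union hS.1 hT.1, by simpa [huT] using hS.2.1, ?_⟩
  have hcardT : T.card ≤ i + 1 := by
    have := hT.2.2
    cases b'
    · simpa [Finset.erase_eq_of_notMem (show v ∉ T by simpa using hT.2.1)] using this
    · have := Finset.card_erase_add_one (hT.2.1.mpr rfl)
      simp only [Bool.toNat_true] at *
      omega
  calc ((S ∪ T).erase u).card ≤ (S.erase u).card + T.card := by
        rw [Finset.erase_union_distrib, Finset.erase_eq_of_notMem huT]
        exact Finset.card_union_le _ _
    _ ≤ g := by have := hS.2.2; omega

theorem MeetAtRoots.grafted_eq_rooted (hDE : MeetAtRoots A D E u v) (b : Bool) {g h : ℕ}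
    (hg : g ≤ h) : grafted D E u v b g h = rooted (D ∪ E) u b g := by
  refine Set.Subset.antisymm ?_ fun S hS => ?_
  · rintro _ (hS | ⟨i, -, hi, b', S, hS, T, hT, rfl⟩)
    · exact ⟨hS.1.trans Finset.subset_union_left, hS.2⟩
    · exact hDE.union_mem_rooted hi hS hT
  have huE : u ∉ S ∩ E := fun hu =>
    Finset.disjoint_left.mp hDE.disjoint hDE.left_mem (Finset.mem_inter.mp hu).2
  have hsplit : (S ∩ D) ∪ (S ∩ E) = S := by
    rw [← Finset.inter_union_distrib_left, Finset.inter_eq_left.mpr hS.1]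
  have huS : u ∈ S ∩ D ↔ b = true := by simpa [hDE.left_mem] using hS.2.1
  have hcard : ((S ∩ D).erase u).card + (S ∩ E).card ≤ g := by
    rw [← Finset.card_union_of_disjoint, ← Finset.erase_eq_of_notMem huE,
      ← Finset.erase_union_distrib, hsplit]
    · exact hS.2.2
    · exact hDE.disjoint.mono ((Finset.erase_subset _ _).trans Finset.inter_subset_right)
        Finset.inter_subset_right
  rcases Nat.eq_zero_or_pos (S ∩ E).card with hE | hE
  · refine .inl ⟨?_, hS.2.1, hS.2.2⟩
    rw [← hsplit, Finset.card_eq_zero.mp hE, Finset.union_empty]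
    exact Finset.inter_subset_right
  · refine .inr ⟨(S ∩ E).card - 1, by omega, by omega, decide (v ∈ S ∩ E), S ∩ D,
      ⟨Finset.inter_subset_right, huS, by omega⟩, S ∩ E,
      ⟨Finset.inter_subset_right, by simp, ?_⟩, hsplit⟩
    by_cases hv : v ∈ S ∩ E <;> simp [Finset.card_erase_of_mem, hv]; omega

end Coverage

section RootMap

variable {ι α : Type*}

/-- A partition of the family `A` into blocks with the set `R` of roots: `ρ` sends each index to the
root of its block, and sets in different blocks meet only if their indices are roots. -/
structure IsRootMap (A : ι → Finset α) (R : Finset ι) (ρ : ι → ι) : Prop where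
  mem : ∀ a, ρ a ∈ R
  eq_self : ∀ r ∈ R, ρ r = r
  eq_self_of_not_disjoint : ∀ a b, ρ a ≠ ρ b → ¬ Disjoint (A a) (A b) → ρ a = a

theorem isRootMap_id [Fintype ι] (A : ι → Finset α) : IsRootMap A Finset.univ id :=
  ⟨fun _ => Finset.mem_univ _, fun _ _ => rfl, fun _ _ _ _ => rfl⟩

/-- Among the sets of the family `A` with index in `R`, the set `A v` meets at most `A u`. -/
structure IsLeaf (A : ι → Finset α) (R : Finset ι) (v u : ι) : Prop where
  left_mem : v ∈ R
  right_mem : u ∈ R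
  ne : v ≠ u
  disjoint : ∀ w ∈ R, w ≠ v → w ≠ u → Disjoint (A v) (A w)

variable [DecidableEq ι]

/-- The root map after the block of `v` has been merged into the block of `u`. -/
def redirect (ρ : ι → ι) (v u : ι) : ι → ι := fun a => if ρ a = v then u else ρ a

theorem IsRootMap.redirect {A : ι → Finset α} {R : Finset ι} {ρ : ι → ι} (h : IsRootMap A R ρ)
    {v u : ι} (hvu : IsLeaf A R v u) : IsRootMap A (R.erase v) (redirect ρ v u) where
  mem a := by
    unfold WMC.redirect
    split_ifs with ha
    exacts [Finset.mem_erase.mpr ⟨hvu.ne.symm, hvu.right_mem⟩, Finset.mem_erase.mpr ⟨ha, h.mem a⟩]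
  eq_self r hr := by
    obtain ⟨hrv, hr⟩ := Finset.mem_erase.mp hr
    simp [WMC.redirect, h.eq_self r hr, hrv]
  eq_self_of_not_disjoint a b hab hdisj := by
    have hρ : ρ a ≠ ρ b := fun heq => hab (by simp only [WMC.redirect, heq])
    have ha := h.eq_self_of_not_disjoint a b hρ hdisj
    have hb := h.eq_self_of_not_disjoint b a hρ.symm (fun hd => hdisj hd.symm)
    simp only [WMC.redirect, ha, hb] at hab ⊢
    refine if_neg fun hav => ?_
    subst hav
    rw [if_pos rfl, if_neg (by rw [← ha, ← hb]; exact hρ.symm)] at hab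
    exact hdisj (hvu.disjoint b (hb ▸ h.mem b) (by rw [← ha, ← hb]; exact hρ.symm) hab.symm)

variable [Fintype ι]

/-- The block with root `r`. -/
def block (ρ : ι → ι) (r : ι) : Finset ι := Finset.univ.filter (ρ · = r)

theorem IsRootMap.meetAtRoots {A : ι → Finset α} {R : Finset ι} {ρ : ι → ι} (h : IsRootMap A R ρ)
    {u v : ι} (hu : u ∈ R) (hv : v ∈ R) (huv : u ≠ v) :
    MeetAtRoots A (block ρ u) (block ρ v) u v where
  left_mem := by simp [block, h.eq_self u hu]
  right_mem := by simp [block, h.eq_self v hv]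
  disjoint := Finset.disjoint_filter.mpr fun a _ hau hav => huv (hau.symm.trans hav)
  eq_roots a ha b hb hdisj := by
    simp only [block, Finset.mem_filter_univ] at ha hb
    have hab : ρ a ≠ ρ b := by rwa [ha, hb]
    exact ⟨(h.eq_self_of_not_disjoint a b hab hdisj).symm.trans ha,
      (h.eq_self_of_not_disjoint b a hab.symm fun hd => hdisj hd.symm).symm.trans hb⟩

theorem block_redirect_self (ρ : ι → ι) {v u : ι} (huv : v ≠ u) :
    block (redirect ρ v u) u = block ρ u ∪ block ρ v := by
  ext a
  simp only [block, Finset.mem_union, Finset.mem_filter_univ, redirect]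
  by_cases ha : ρ a = v <;> simp [ha, huv]

theorem block_redirect_of_ne (ρ : ι → ι) {v u w : ι} (hwv : w ≠ v) (hwu : w ≠ u) :
    block (redirect ρ v u) w = block ρ w := by
  ext a
  simp only [block, Finset.mem_filter_univ]
  unfold redirect
  split_ifs with ha
  · simp only [ha, hwu.symm, hwv.symm]
  · rfl

end RootMap

open RealRAM RealRAM.ForProgram

local notation:50 c:51 ";;" d:50 => ForProgram.seq c d

/- The names of the arrays of natural numbers. The array `0` holds `N`, `M` and `G`, the array `1`
the bi-adjacency matrix, and the arrays `2` and `3` are read by `outputGroups` and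
`outputVariables`. Of the arrays named `…Reg`, only the cell `0` is used. -/
abbrev incidenceArray : ℕ := 1
abbrev selectionArray : ℕ := 2
abbrev coveredArray : ℕ := 3
abbrev multipleArray : ℕ := 4
abbrev squareArray : ℕ := 5
abbrev rowArray : ℕ := 6
abbrev deadArray : ℕ := 7
abbrev flagReg : ℕ := 8
abbrev targetReg : ℕ := 9
abbrev leftReg : ℕ := 10
abbrev rightReg : ℕ := 11
abbrev variableReg : ℕ := 12
abbrev groupReg : ℕ := 13
abbrev childReg : ℕ := 14
abbrev parentReg : ℕ := 15
abbrev sizeReg : ℕ := 16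
abbrev shareReg : ℕ := 17
abbrev passReg : ℕ := 18

/- The real array `0` holds the signal. -/
abbrev candidateReg : ℕ := 1
abbrev incumbentReg : ℕ := 2

attribute [simp] incidenceArray selectionArray coveredArray multipleArray squareArray rowArray
  deadArray flagReg targetReg leftReg rightReg variableReg groupReg childReg parentReg sizeReg
  shareReg passReg candidateReg incumbentReg

variable {N M : ℕ} {𝔊 : GroupStructure N M} {G : ℕ} {x : Fin N → ℝ} {s s' : Store}

/-- The memory holds the instance, and the multiples of `M` and of `M * M` that are needed for
addressing, since the machine cannot multiply addresses. -/
structure Ready (𝔊 : GroupStructure N M) (G : ℕ) (x : Fin N → ℝ) (s : Store) : Prop where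
  variableCount : s.nat 0 0 = N
  groupCount : s.nat 0 1 = M
  budget : s.nat 0 2 = G
  biadj : ∀ (i : Fin N) (l : Fin M),
    s.nat incidenceArray (i * M + l) = if i ∈ 𝔊.group l then 1 else 0
  signal : ∀ i : Fin N, s.real 0 i = x i
  multiple : ∀ i, i ≤ N ∨ i ≤ M → s.nat multipleArray i = i * M
  square : ∀ i ≤ M, s.nat squareArray i = i * (M * M)

/-- The program does not change what `Ready` speaks about. -/
abbrev KeepsReady (c : ForProgram) : Prop :=
  (∀ a ∈ [0, incidenceArray, multipleArray, squareArray], a ∉ c.natWrites) ∧ 0 ∉ c.realWrites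

theorem Ready.of_frame {c : ForProgram} (h : Ready 𝔊 G x s) (hf : Frame c s s')
    (hc : KeepsReady c := by exact of_decide_eq_true rfl) : Ready 𝔊 G x s' := by
  have h0 := hf.nat (hc.1 0 (by simp))
  have h1 := hf.nat (hc.1 incidenceArray (by simp))
  have h4 := hf.nat (hc.1 multipleArray (by simp))
  have h5 := hf.nat (hc.1 squareArray (by simp))
  exact ⟨h0 ▸ h.variableCount, h0 ▸ h.groupCount, h0 ▸ h.budget, h1 ▸ h.biadj,
    hf.real hc.2 ▸ h.signal, h4 ▸ h.multiple, h5 ▸ h.square⟩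

/-- The set of groups stored in the `k`-th stretch of `M` cells of `rowArray`, by nonzero cells. -/
def row (M : ℕ) (s : Store) (k : ℕ) : Finset (Fin M) :=
  Finset.univ.filter fun l => s.nat rowArray (k * M + l) ≠ 0

theorem mem_row {k : ℕ} {l : Fin M} : l ∈ row M s k ↔ s.nat rowArray (k * M + l) ≠ 0 := by
  simp [row]

theorem row_of_frame {c : ForProgram} (hf : Frame c s s')
    (hc : rowArray ∉ c.natWrites := by exact of_decide_eq_true rfl) : row M s' = row M s := by
  unfold row
  rw [hf.nat hc]

theorem mul_add_inj {k k' l l' : ℕ} (hl : l < M) (hl' : l' < M) :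
    k * M + l = k' * M + l' ↔ k = k' ∧ l = l' := by
  refine ⟨fun h => ?_, by rintro ⟨rfl, rfl⟩; rfl⟩
  have hk : k = k' := by
    simpa [Nat.mul_add_div (by omega : 0 < M), Nat.div_eq_of_lt, hl, hl', mul_comm _ M] using
      congrArg (· / M) h
  subst hk
  exact ⟨rfl, by omega⟩

theorem exists_fin_lt_add_one {n m : ℕ} (hm : m < n) {p : Fin n → Prop} :
    (∃ i : Fin n, i.val < m + 1 ∧ p i) ↔ (∃ i : Fin n, i.val < m ∧ p i) ∨ p ⟨m, hm⟩ := by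
  simp only [Nat.lt_add_one_iff_lt_or_eq, or_and_right, exists_or]
  refine or_congr_right ⟨?_, fun h => ⟨_, rfl, h⟩⟩
  rintro ⟨i, rfl, h⟩
  exact h

theorem filter_fin_lt_add_one {n m : ℕ} (hm : m < n) (C : Finset (Fin n)) :
    C.filter (·.val < m + 1) = if ⟨m, hm⟩ ∈ C then
      insert ⟨m, hm⟩ (C.filter (·.val < m)) else C.filter (·.val < m) := by
  ext i
  split_ifs with h <;>
    simp only [Finset.mem_insert, Finset.mem_filter, Nat.lt_add_one_iff_lt_or_eq, Fin.ext_iff]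
  · by_cases hi : i.val = m
    · obtain rfl : i = ⟨m, hm⟩ := Fin.ext hi
      simp [h]
    · simp [hi]
  · have : i ∈ C → i.val ≠ m := fun hi him => h ((Fin.ext him : i = ⟨m, hm⟩) ▸ hi)
    tauto

/-- The total weight of the variables covered by a set of groups. -/
abbrev weight (𝔊 : GroupStructure N M) (x : Fin N → ℝ) : Finset (Fin M) → ℝ :=
  coverage 𝔊.group fun i => x i ^ 2

/-- The contents of the cell with index `l` of the row at the address in the register `p`. -/
abbrev rowCell (p l : ℕ) : NatExpr := .load rowArray (.add (reg p) (reg l))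

/-- The current variable belongs to the group in the register `p`. -/
abbrev memberTest (p : ℕ) : Test :=
  .natLe (.lit 1) (.load incidenceArray (.add (.load multipleArray (reg variableReg)) (reg p)))

theorem Ready.holds_memberTest (h : Ready 𝔊 G x s) {p : ℕ} {i : Fin N} {l : Fin M}
    (hi : s.nat variableReg 0 = i) (hp : s.nat p 0 = l) :
    (memberTest p).Holds s ↔ i ∈ 𝔊.group l := by
  simp only [Test.Holds, NatExpr.value, hp, hi, h.multiple i (.inl i.2.le), h.biadj]
  split_ifs <;> simp_all

/-- Stores in `coveredArray` whether the current variable lies in a group of the union of the rows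
at the addresses in the registers `p` and `q`. -/
def coverVariable (p q : ℕ) : ForProgram :=
  .setNat coveredArray (reg variableReg) (.lit 0) ;;
  .forLoop groupReg 1
    (.ite (.and (.natLe (.lit 1) (.add (rowCell p groupReg) (rowCell q groupReg)))
        (memberTest groupReg))
      (.setNat coveredArray (reg variableReg) (.lit 1))
      .skip)

theorem eval_coverVariable (h : Ready 𝔊 G x s) {p q k₁ k₂ : ℕ}
    (hp : s.nat p 0 = k₁ * M) (hpw : p ∉ (coverVariable p q).natWrites)
    (hq : s.nat q 0 = k₂ * M) (hqw : q ∉ (coverVariable p q).natWrites)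
    {i : Fin N} (hi : s.nat variableReg 0 = i) (j : ℕ) :
    ((coverVariable p q).eval s).nat coveredArray j =
      if j = i then if i ∈ (row M s k₁ ∪ row M s k₂).biUnion 𝔊.group then 1 else 0
      else s.nat coveredArray j := by
  let P (m : ℕ) (s' : Store) : Prop := ∀ j, s'.nat coveredArray j =
    if j = i then
      if ∃ l : Fin M, l.val < m ∧ l ∈ row M s k₁ ∪ row M s k₂ ∧ i ∈ 𝔊.group l then 1 else 0
    else s.nat coveredArray j
  suffices P M ((coverVariable p q).eval s) by
    simpa [P] using this j
  rw [coverVariable, eval_seq]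
  refine eval_forLoop_induction P h.groupCount (fun _ _ _ hP => hP) ?_ ?_
  · simp [P, hi]
  · intro m hm s' hf hcount ih j
    have hf' : Frame (coverVariable p q) s s' :=
      (frame_eval (.setNat coveredArray (reg variableReg) (.lit 0)) s).seq hf
    have hkeep : KeepsReady (coverVariable p q) := ⟨by simp [coverVariable], by
      simp [coverVariable, realWrites]⟩
    have hv : s'.nat variableReg 0 = i := by rw [hf'.nat (by simp [coverVariable]), hi]
    have hcond : (Test.and (.natLe (.lit 1) (.add (rowCell p groupReg) (rowCell q groupReg)))
        (memberTest groupReg)).Holds s' ↔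
        (⟨m, hm⟩ : Fin M) ∈ row M s k₁ ∪ row M s k₂ ∧ i ∈ 𝔊.group ⟨m, hm⟩ := by
      refine and_congr ?_ ((h.of_frame hf' hkeep).holds_memberTest hv hcount)
      simp only [Test.Holds, NatExpr.value, hcount, hf'.nat hpw, hf'.nat hqw, hp, hq,
        hf'.nat (a := rowArray) (by simp [coverVariable]), Finset.mem_union, mem_row]
      omega
    have ihj : s'.nat coveredArray j = _ := ih j
    simp only [eval, hcond, exists_fin_lt_add_one hm]
    by_cases hC : (⟨m, hm⟩ : Fin M) ∈ row M s k₁ ∪ row M s k₂ ∧ i ∈ 𝔊.group ⟨m, hm⟩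
    · by_cases hj : j = i <;> simp [hC, hv, ihj, hj]
    · simpa only [hC, or_false, if_false] using ihj

/-- Like `coverVariable`, and if the current variable is covered, adds its weight to the real
register `r`. -/
def weighVariable (p q r : ℕ) : ForProgram :=
  coverVariable p q ;;
  .ite (.natLe (.lit 1) (.load coveredArray (reg variableReg)))
    (.setReal r (.lit 0) (.add (.load r (.lit 0))
      (.mul (.load 0 (reg variableReg)) (.load 0 (reg variableReg)))))
    .skip

theorem eval_weighVariable (h : Ready 𝔊 G x s) {p q r k₁ k₂ : ℕ}
    (hp : s.nat p 0 = k₁ * M) (hpw : p ∉ (weighVariable p q r).natWrites)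
    (hq : s.nat q 0 = k₂ * M) (hqw : q ∉ (weighVariable p q r).natWrites)
    {i : Fin N} (hi : s.nat variableReg 0 = i) {C : Finset (Fin N)}
    (hC : (row M s k₁ ∪ row M s k₂).biUnion 𝔊.group = C) :
    ((weighVariable p q r).eval s).real r 0 = (s.real r 0 + if i ∈ C then x i ^ 2 else 0) ∧
      ∀ j, ((weighVariable p q r).eval s).nat coveredArray j =
        if j = i then if i ∈ C then 1 else 0 else s.nat coveredArray j := by
  have hcover := eval_coverVariable h hp (by simp_all [weighVariable]) hq
    (by simp_all [weighVariable]) hi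
  have hf : Frame (coverVariable p q) s _ := frame_eval _ s
  rw [weighVariable, eval_seq]
  set s' := (coverVariable p q).eval s
  have hv : s'.nat variableReg 0 = i := by rw [hf.nat (by simp [coverVariable]), hi]
  have hreal : s'.real = s.real := funext fun _ => hf.real (by simp [coverVariable])
  rw [hC] at hcover
  have hcond : (Test.natLe (.lit 1) (.load coveredArray (reg variableReg))).Holds s' ↔ i ∈ C := by
    simp only [Test.Holds, NatExpr.value, hv, hcover]
    split_ifs <;> simp_all
  simp only [eval, hcond]
  split_ifs with hiC
  · simp [hreal, hv, h.signal, hcover, hiC, pow_two]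
  · simp [hreal, hcover, hiC]

/-- Stores in the real register `r` the weight of the union of the rows at the addresses in the
registers `p` and `q`. -/
def weigh (p q r : ℕ) : ForProgram :=
  .setReal r (.lit 0) (.lit 0) ;;
  .forLoop variableReg 0 (weighVariable p q r)

theorem eval_weigh (h : Ready 𝔊 G x s) {p q r k₁ k₂ : ℕ} (hp : s.nat p 0 = k₁ * M)
    (hpw : p ∉ (weigh p q r).natWrites) (hq : s.nat q 0 = k₂ * M)
    (hqw : q ∉ (weigh p q r).natWrites) (hr : r ≠ 0) :
    ((weigh p q r).eval s).real r 0 = weight 𝔊 x (row M s k₁ ∪ row M s k₂) ∧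
      ∀ i : Fin N, ((weigh p q r).eval s).nat coveredArray i =
        if i ∈ (row M s k₁ ∪ row M s k₂).biUnion 𝔊.group then 1 else 0 := by
  set C := (row M s k₁ ∪ row M s k₂).biUnion 𝔊.group with hC
  let P (m : ℕ) (s' : Store) : Prop :=
    s'.real r 0 = ∑ i ∈ C.filter (·.val < m), x i ^ 2 ∧
      ∀ i : Fin N, i.val < m → s'.nat coveredArray i = if i ∈ C then 1 else 0
  suffices P N ((weigh p q r).eval s) by simpa [P, coverage, hC] using this
  rw [weigh, eval_seq]
  refine eval_forLoop_induction P h.variableCount (fun _ _ _ hP => hP) (by simp [P]) ?_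
  intro m hm s' hf hcount ih
  have hf' : Frame (weigh p q r) s s' := (frame_eval (.setReal r (.lit 0) (.lit 0)) s).seq hf
  have hkeep : KeepsReady (weigh p q r) := ⟨by simp [weigh, weighVariable, coverVariable], by
    simpa [weigh, weighVariable, coverVariable] using hr.symm⟩
  have hrow := row_of_frame (M := M) hf' (by simp [weigh, weighVariable, coverVariable])
  obtain ⟨hreal, hcells⟩ := eval_weighVariable (r := r) (h.of_frame hf' hkeep) (i := ⟨m, hm⟩)
    ((congrFun (hf'.nat hpw) 0).trans hp) (by simp_all [weigh])
    ((congrFun (hf'.nat hqw) 0).trans hq) (by simp_all [weigh]) hcount (C := C) (by rw [hrow])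
  refine ⟨?_, fun i hi => ?_⟩
  · rw [hreal, ih.1, filter_fin_lt_add_one hm]
    split_ifs with hmC
    · rw [Finset.sum_insert (by simp), add_comm]
    · rw [add_zero]
  · rw [hcells]
    by_cases him : i.val = m
    · simp [← him]
    · simpa [him] using ih.2 i (by omega)

/-- Replaces the row at the address in `targetReg` by the union of those at the addresses in
`leftReg` and `rightReg`. -/
def copyUnion : ForProgram :=
  .forLoop groupReg 1
    (.setNat rowArray (.add (reg targetReg) (reg groupReg))
      (.add (rowCell leftReg groupReg) (rowCell rightReg groupReg)))

theorem row_eval_copyUnion (h : Ready 𝔊 G x s) {k k₁ k₂ : ℕ} (hk : s.nat targetReg 0 = k * M)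
    (hk₁ : s.nat leftReg 0 = k₁ * M) (hk₂ : s.nat rightReg 0 = k₂ * M) :
    row M (copyUnion.eval s) = Function.update (row M s) k (row M s k₁ ∪ row M s k₂) := by
  let P (m : ℕ) (s' : Store) : Prop := ∀ j, ∀ l : Fin M, s'.nat rowArray (j * M + l) =
    if j = k ∧ l.val < m then s.nat rowArray (k₁ * M + l) + s.nat rowArray (k₂ * M + l)
    else s.nat rowArray (j * M + l)
  suffices hP : P M (copyUnion.eval s) by
    ext j l
    rw [mem_row, hP]
    by_cases hj : j = k <;> simp [hj, mem_row]
    tauto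
  refine eval_forLoop_induction P h.groupCount (fun _ _ _ hP => hP) (by simp [P]) ?_
  intro m hm s' hf hcount ih j l
  have h₁ := ih k₁ ⟨m, hm⟩
  have h₂ := ih k₂ ⟨m, hm⟩
  simp only [lt_irrefl, and_false, if_false] at h₁ h₂
  have hreg {a : ℕ} (ha : a ∉ [groupReg, rowArray]) : s'.nat a = s.nat a := hf.nat ha
  simp only [eval, NatExpr.value, hreg (a := targetReg) (by decide), hk,
    hreg (a := leftReg) (by decide), hk₁, hreg (a := rightReg) (by decide), hk₂, hcount, h₁, h₂,
    nat_setNat, mul_add_inj l.2 hm, true_and]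
  by_cases hl : l.val = m
  · subst hl
    simp [ih j l]
  · simp [hl, ih j l, Nat.lt_add_one_iff_lt_or_eq, -Order.lt_add_one_iff]

/-- Replaces the row at the address in `targetReg` by the union of those at the addresses in
`leftReg` and `rightReg` if that union is heavier. -/
def improveTarget : ForProgram :=
  weigh leftReg rightReg candidateReg ;;
  weigh targetReg targetReg incumbentReg ;;
  .ite (.not (.realLe (.load candidateReg (.lit 0)) (.load incumbentReg (.lit 0)))) copyUnion .skip

theorem row_eval_improveTarget (h : Ready 𝔊 G x s) {k k₁ k₂ : ℕ} (hk : s.nat targetReg 0 = k * M)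
    (hk₁ : s.nat leftReg 0 = k₁ * M) (hk₂ : s.nat rightReg 0 = k₂ * M) :
    row M (improveTarget.eval s) =
      Function.update (row M s) k (better (weight 𝔊 x) (row M s k) (row M s k₁ ∪ row M s k₂)) := by
  have hcand := (eval_weigh h hk₁ (by decide) hk₂ (by decide) (show candidateReg ≠ 0 by decide)).1
  have hf₁ : Frame (weigh leftReg rightReg candidateReg) s _ := frame_eval _ s
  rw [improveTarget, eval_seq, eval_seq]
  set s₁ := (weigh leftReg rightReg candidateReg).eval s
  have hk' : s₁.nat targetReg 0 = k * M := (congrFun (hf₁.nat (by decide)) 0).trans hk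
  have hinc := (eval_weigh (h.of_frame hf₁) hk' (by decide) hk' (by decide)
    (show incumbentReg ≠ 0 by decide)).1
  have hf₂ : Frame (weigh targetReg targetReg incumbentReg) s₁ _ := frame_eval _ s₁
  set s₂ := (weigh targetReg targetReg incumbentReg).eval s₁
  have hrow : row M s₂ = row M s := (row_of_frame hf₂).trans (row_of_frame hf₁)
  rw [← hf₂.real (by decide)] at hcand
  rw [row_of_frame hf₁, Finset.union_self] at hinc
  have hreg {a : ℕ} (ha : a ∈ [targetReg, leftReg, rightReg]) : s₂.nat a = s.nat a := by
    fin_cases ha <;> rw [hf₂.nat (by decide), hf₁.nat (by decide)]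
  simp only [eval, Test.Holds, RealExpr.value, NatExpr.value, hcand, hinc, not_le]
  unfold better
  split_ifs
  · rw [row_eval_copyUnion ((h.of_frame hf₁).of_frame hf₂) (by rw [hreg (by decide), hk])
      (by rw [hreg (by decide), hk₁]) (by rw [hreg (by decide), hk₂]), hrow]
  · rw [Function.update_eq_self, hrow]

/-- Replaces the row at the address `d` by the union of the rows at the addresses `p` and `q` if
that union is heavier. -/
def improve (d p q : NatExpr) : ForProgram :=
  .setNat targetReg (.lit 0) d ;;
  .setNat leftReg (.lit 0) p ;;
  .setNat rightReg (.lit 0) q ;;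
  improveTarget

theorem row_eval_improve (h : Ready 𝔊 G x s) {d p q : NatExpr} {k k₁ k₂ : ℕ}
    (hd : d.value s = k * M) (hp : ∀ c, p.value (s.setNat targetReg 0 c) = k₁ * M)
    (hq : ∀ c c', q.value ((s.setNat targetReg 0 c).setNat leftReg 0 c') = k₂ * M) :
    row M ((improve d p q).eval s) =
      Function.update (row M s) k (better (weight 𝔊 x) (row M s k) (row M s k₁ ∪ row M s k₂)) := by
  let load : ForProgram := .setNat targetReg (.lit 0) d ;; .setNat leftReg (.lit 0) p ;;
    .setNat rightReg (.lit 0) q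
  have hf : Frame load s (load.eval s) := frame_eval _ _
  rw [← row_of_frame hf]
  refine row_eval_improveTarget (h.of_frame hf) ?_ ?_ ?_ <;> simp [load, hd, hp, hq]

section

/-- The number of the row for the best set in `rooted D v b g`. -/
def tableRow (M : ℕ) (b : Bool) (v g : ℕ) : ℕ := (b.toNat * M + v) * M + g

theorem tableRow_inj {b b' : Bool} {v v' : Fin M} {g g' : ℕ} (hg : g < M) (hg' : g' < M) :
    tableRow M b v g = tableRow M b' v' g' ↔ (b = b' ∧ v = v') ∧ g = g' := by
  rw [tableRow, tableRow, mul_add_inj hg hg', mul_add_inj v.2 v'.2, Fin.val_inj]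
  cases b <;> cases b' <;> simp

/-- The address of the row `tableRow M b v g`, where `v` is the content of the register `p` and `g`
is the value of `e`. -/
def tableAddr (b : Bool) (p : ℕ) (e : NatExpr) : NatExpr :=
  .add (.add (.load squareArray (.load multipleArray (.lit b.toNat))) (.load squareArray (reg p)))
    (.load multipleArray e)

theorem value_tableAddr (h : Ready 𝔊 G x s) (b : Bool) {p : ℕ} {e : NatExpr} {v : Fin M} {g : ℕ}
    (hp : s.nat p 0 = v) (he : e.value s = g) (hg : g < M) :
    (tableAddr b p e).value s = tableRow M b v g * M := by
  have hb : b.toNat ≤ M := (Bool.toNat_le b).trans (by omega)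
  have hbM : b.toNat * M ≤ M := (Nat.mul_le_mul_right M (Bool.toNat_le b)).trans_eq (one_mul M)
  simp only [tableAddr, NatExpr.value, hp, he, h.multiple _ (.inr hb), h.multiple g (.inr hg.le),
    h.square _ v.2.le, h.square _ hbM, tableRow]
  ring

/-- The table contains the best sets of each size with root `u` in the block `D`. -/
def TableBest (𝔊 : GroupStructure N M) (x : Fin N → ℝ) (s : Store) (D : Finset (Fin M))
    (u : Fin M) : Prop :=
  ∀ b, ∀ g < M, IsBest (weight 𝔊 x) (rooted D u b g) (row M s (tableRow M b u g))

theorem update_tableRow_of_ne {b b' : Bool} {u v : Fin M} {g g' : ℕ} (huv : v ≠ u) (hg : g < M)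
    (hg' : g' < M) (f : ℕ → Finset (Fin M)) (S : Finset (Fin M)) :
    Function.update f (tableRow M b u g) S (tableRow M b' v g') = f (tableRow M b' v g') :=
  Function.update_of_ne (fun h => huv ((tableRow_inj hg' hg).mp h).1.2) _ _

theorem TableBest.of_row_eq {D : Finset (Fin M)} {u : Fin M} (h : TableBest 𝔊 x s D u)
    (heq : ∀ b, ∀ g < M, row M s' (tableRow M b u g) = row M s (tableRow M b u g)) :
    TableBest 𝔊 x s' D u :=
  fun b g hg => heq b g hg ▸ h b g hg

/-- The size `g` of the row under treatment. The rows are treated by decreasing size, so that the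
rows read still belong to the block of the parent alone. -/
abbrev sizeExpr : NatExpr := .sub (.load 0 (.lit 1)) (.add (reg sizeReg) (.lit 1))

/-- The block of `v` is being merged into the block of `u`, and the rows of size `g` are under
treatment. -/
structure Merging (𝔊 : GroupStructure N M) (G : ℕ) (x : Fin N → ℝ) (u v : Fin M) (g : ℕ)
    (s : Store) : Prop extends Ready 𝔊 G x s where
  parent : s.nat parentReg 0 = u
  child : s.nat childReg 0 = v
  size : sizeExpr.value s = g
  size_lt : g < M

theorem Merging.of_frame {u v : Fin M} {g : ℕ} {c : ForProgram} (h : Merging 𝔊 G x u v g s)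
    (hf : Frame c s s') (hr : KeepsReady c := by exact of_decide_eq_true rfl)
    (hc : ∀ a ∈ [parentReg, childReg, sizeReg], a ∉ c.natWrites := by exact of_decide_eq_true rfl) :
    Merging 𝔊 G x u v g s' where
  toReady := h.toReady.of_frame hf hr
  parent := hf.nat (hc parentReg (by decide)) ▸ h.parent
  child := hf.nat (hc childReg (by decide)) ▸ h.child
  size := by
    have hsize := h.size
    simp only [NatExpr.value] at hsize ⊢
    rw [hf.nat (hr.1 0 (by decide)), hf.nat (hc sizeReg (by decide)), hsize]
  size_lt := h.size_lt

variable {u v : Fin M} {D E : Finset (Fin M)} {g : ℕ}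

/-- The number of groups taken from the block of the child. -/
abbrev shareExpr : NatExpr := .add (reg shareReg) (.lit 1)

/-- Compares the current row of the parent with the sets that are obtained from the block of the
child, of whose root `b'` says whether it belongs to the set. -/
def join (b b' : Bool) : ForProgram :=
  improve (tableAddr b parentReg sizeExpr) (tableAddr b parentReg (.sub sizeExpr shareExpr))
    (tableAddr b' childReg (.sub shareExpr (.lit b'.toNat)))

theorem row_eval_join (h : Merging 𝔊 G x u v g s) (b b' : Bool) {i : ℕ}
    (hi : s.nat shareReg 0 = i) (hig : i < g) :
    row M ((join b b').eval s) = Function.update (row M s) (tableRow M b u g)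
      (better (weight 𝔊 x) (row M s (tableRow M b u g))
        (row M s (tableRow M b u (g - (i + 1))) ∪
          row M s (tableRow M b' v (i + 1 - b'.toNat)))) := by
  have hdiff : (NatExpr.sub sizeExpr shareExpr).value s = g - (i + 1) := by
    rw [← hi, ← h.size]
    rfl
  have hshare : (NatExpr.sub shareExpr (.lit b'.toNat)).value s = i + 1 - b'.toNat := by
    rw [← hi]
    rfl
  have hgM := h.size_lt
  exact row_eval_improve h.toReady (value_tableAddr h.toReady b h.parent h.size h.size_lt)
    (fun _ => value_tableAddr h.toReady b h.parent hdiff (by omega))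
    (fun _ _ => value_tableAddr h.toReady b' h.child hshare (by omega))

theorem row_eval_join_join (h : Merging 𝔊 G x u v g s) {i : ℕ} {b : Bool}
    (hi : s.nat shareReg 0 = i) (hig : i < g) (hDE : MeetAtRoots 𝔊.group D E u v)
    (hD : IsBest (weight 𝔊 x) (rooted D u b (g - (i + 1))) (row M s (tableRow M b u (g - (i + 1)))))
    (hE : TableBest 𝔊 x s E v)
    (hS : IsBest (weight 𝔊 x) (grafted D E u v b g i) (row M s (tableRow M b u g))) :
    ∃ S, IsBest (weight 𝔊 x) (grafted D E u v b g (i + 1)) S ∧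
      row M ((join b false ;; join b true).eval s) =
        Function.update (row M s) (tableRow M b u g) S := by
  have hgM := h.size_lt
  have hne : tableRow M b u (g - (i + 1)) ≠ tableRow M b u g := fun heq => by
    have := ((tableRow_inj (by omega) hgM).mp heq).2
    omega
  have hrow := row_eval_join h b false hi hig
  have hf : Frame (join b false) s _ := frame_eval _ s
  rw [eval_seq]
  set s' := (join b false).eval s
  have hrow' := row_eval_join (h.of_frame hf) b true (i := i)
    (by rw [hf.nat (of_decide_eq_true rfl), hi]) hig
  rw [hrow, Function.update_self, Function.update_idem, Function.update_of_ne hne,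
    update_tableRow_of_ne hDE.ne hgM (by rw [Bool.toNat_true]; omega)] at hrow'
  refine ⟨_, ?_, hrow'⟩
  rw [grafted_succ b hig]
  exact (hS.better (hDE.isBest_union hD (hE false (i + 1) (by omega)))).better
    (hDE.isBest_union hD (hE true i (by omega)))

/-- Treats the current row. -/
def mergeRow (b : Bool) : ForProgram :=
  .forLoop shareReg 1 (.ite (.natLe shareExpr sizeExpr) (join b false ;; join b true) .skip)

theorem row_eval_mergeRow (h : Merging 𝔊 G x u v g s) (b : Bool)
    (hDE : MeetAtRoots 𝔊.group D E u v)
    (hD : ∀ g' ≤ g, IsBest (weight 𝔊 x) (rooted D u b g') (row M s (tableRow M b u g')))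
    (hE : TableBest 𝔊 x s E v) :
    ∃ S, IsBest (weight 𝔊 x) (rooted (D ∪ E) u b g) S ∧
      row M ((mergeRow b).eval s) = Function.update (row M s) (tableRow M b u g) S := by
  have hgM := h.size_lt
  let P (m : ℕ) (s' : Store) : Prop := ∃ S, IsBest (weight 𝔊 x) (grafted D E u v b g m) S ∧
    row M s' = Function.update (row M s) (tableRow M b u g) S
  suffices P M ((mergeRow b).eval s) by simpa only [P, hDE.grafted_eq_rooted b hgM.le] using this
  refine eval_forLoop_induction P h.groupCount (fun _ _ _ hP => hP) ?_ ?_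
  · exact ⟨_, by rw [grafted_zero]; exact hD g le_rfl, (Function.update_eq_self _ _).symm⟩
  rintro i - s' hf hi ⟨S, hS, hrow⟩
  have h' := h.of_frame hf
  have hcond : (Test.natLe shareExpr sizeExpr).Holds s' ↔ i < g := by
    rw [Test.Holds, h'.size, ← hi]
    rfl
  simp only [eval, hcond]
  split_ifs with hig
  · have hne : tableRow M b u (g - (i + 1)) ≠ tableRow M b u g := fun heq => by
      have := ((tableRow_inj (by omega) hgM).mp heq).2
      omega
    obtain ⟨S', hS', hrow'⟩ := row_eval_join_join h' hi hig hDE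
      (by rw [hrow, Function.update_of_ne hne]; exact hD _ (by omega))
      (hE.of_row_eq fun b' g' hg' => by rw [hrow, update_tableRow_of_ne hDE.ne hgM hg'])
      (by rwa [hrow, Function.update_self])
    exact ⟨S', hS', by rw [eval_seq] at hrow'; rw [hrow', hrow, Function.update_idem]⟩
  · exact ⟨S, by rwa [grafted_succ_of_le b (not_lt.mp hig)], hrow⟩

theorem row_eval_mergeRow_mergeRow (h : Merging 𝔊 G x u v g s)
    (hDE : MeetAtRoots 𝔊.group D E u v)
    (hD : ∀ b, ∀ g' ≤ g, IsBest (weight 𝔊 x) (rooted D u b g') (row M s (tableRow M b u g')))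
    (hE : TableBest 𝔊 x s E v) :
    ∃ S : Bool → Finset (Fin M), (∀ b, IsBest (weight 𝔊 x) (rooted (D ∪ E) u b g) (S b)) ∧
      ∀ b (w : Fin M), ∀ g' < M,
        row M ((mergeRow false ;; mergeRow true).eval s) (tableRow M b w g') =
          if w = u ∧ g' = g then S b else row M s (tableRow M b w g') := by
  have hgM := h.size_lt
  have hf : Frame (mergeRow false) s _ := frame_eval _ s
  obtain ⟨S₀, hS₀, hrow₀⟩ := row_eval_mergeRow h false hDE (hD false) hE
  rw [eval_seq]
  set s' := (mergeRow false).eval s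
  obtain ⟨S₁, hS₁, hrow₁⟩ := row_eval_mergeRow (h.of_frame hf) true hDE
    (fun g' hg' => by
      rw [hrow₀, Function.update_of_ne (by rw [Ne, tableRow_inj (by omega) hgM]; simp)]
      exact hD true g' hg')
    (hE.of_row_eq fun b g' hg' => by rw [hrow₀, update_tableRow_of_ne hDE.ne hgM hg'])
  refine ⟨fun b => if b then S₁ else S₀, by simp [hS₀, hS₁], fun b w g' hg' => ?_⟩
  simp only [hrow₁, hrow₀, Function.update_apply, tableRow_inj hg' hgM]
  cases b <;> simp

/-- Merges the block of the child into the block of the parent. -/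
def merge : ForProgram :=
  .forLoop sizeReg 1 (mergeRow false ;; mergeRow true)

theorem tableBest_eval_merge (h : Ready 𝔊 G x s) (hu : s.nat parentReg 0 = u)
    (hv : s.nat childReg 0 = v) (hDE : MeetAtRoots 𝔊.group D E u v)
    (hD : TableBest 𝔊 x s D u) (hE : TableBest 𝔊 x s E v) :
    TableBest 𝔊 x (merge.eval s) (D ∪ E) u ∧
      ∀ w : Fin M, w ≠ u → ∀ b, ∀ g < M,
        row M (merge.eval s) (tableRow M b w g) = row M s (tableRow M b w g) := by
  let P (m : ℕ) (s' : Store) : Prop :=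
    (∀ b, ∀ g < M, IsBest (weight 𝔊 x) (rooted (if g < M - m then D else D ∪ E) u b g)
      (row M s' (tableRow M b u g))) ∧
    ∀ w : Fin M, w ≠ u → ∀ b, ∀ g < M,
      row M s' (tableRow M b w g) = row M s (tableRow M b w g)
  suffices P M (merge.eval s) by simpa [P, TableBest] using this
  refine eval_forLoop_induction P h.groupCount (fun _ _ _ hP => hP) ?_ ?_
  · exact ⟨fun b g hg => by simpa [hg] using hD b g hg, fun _ _ _ _ _ => rfl⟩
  rintro m hm s' hf hcount ⟨hbest, hother⟩
  have hready := h.of_frame hf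
  have h' : Merging 𝔊 G x u v (M - (m + 1)) s' :=
    { hready with
      parent := hf.nat (a := parentReg) (by decide) ▸ hu
      child := hf.nat (a := childReg) (by decide) ▸ hv
      size := congrArg₂ (fun a b => a - (b + 1)) hready.groupCount hcount
      size_lt := by omega }
  obtain ⟨S, hS, hrow⟩ := row_eval_mergeRow_mergeRow h' hDE
    (fun b g hg => by simpa [show g < M - m by omega] using hbest b g (by omega))
    (hE.of_row_eq (hother v hDE.ne))
  refine ⟨fun b g hg => ?_, fun w hw b g hg => ?_⟩
  · rw [hrow b u g hg]
    by_cases hgm : g = M - (m + 1)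
    · simpa [hgm] using hS b
    · have hlt : g < M - (m + 1) ↔ g < M - m := by omega
      simpa [hgm, hlt] using hbest b g hg
  · rw [hrow b w g hg, if_neg (fun hwu => hw hwu.1), hother w hw b g hg]

end

section

/-- The groups that still are the roots of blocks. -/
def alive (M : ℕ) (s : Store) : Finset (Fin M) :=
  Finset.univ.filter fun l => s.nat deadArray l = 0

theorem mem_alive {l : Fin M} : l ∈ alive M s ↔ s.nat deadArray l = 0 := by
  simp [alive]

theorem alive_of_frame {c : ForProgram} (hf : Frame c s s')
    (hc : deadArray ∉ c.natWrites := by exact of_decide_eq_true rfl) : alive M s' = alive M s := by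
  unfold alive
  rw [hf.nat hc]

/-- The group in the register `p` is alive. -/
abbrev aliveTest (p : ℕ) : Test := .natLe (.load deadArray (reg p)) (.lit 0)

theorem holds_aliveTest {p : ℕ} {l : Fin M} (hp : s.nat p 0 = l) :
    (aliveTest p).Holds s ↔ l ∈ alive M s := by
  simp [hp, mem_alive]

/-- The registers `p` and `q` differ. -/
abbrev neTest (p q : ℕ) : Test := .not (.and (.natLe (reg p) (reg q)) (.natLe (reg q) (reg p)))

theorem holds_neTest {p q : ℕ} {l l' : Fin M} (hp : s.nat p 0 = l) (hq : s.nat q 0 = l') :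
    (neTest p q).Holds s ↔ l ≠ l' := by
  simp only [Test.Holds, NatExpr.value, hp, hq, Ne, Fin.ext_iff]
  omega

variable {u v w : Fin M}

/-- Raises the flag if the child meets the current group. -/
def flagMeeting : ForProgram :=
  .forLoop variableReg 0 (.ite (.and (memberTest childReg) (memberTest groupReg))
    (.setNat flagReg (.lit 0) (.lit 1)) .skip)

theorem eval_flagMeeting (h : Ready 𝔊 G x s) (hv : s.nat childReg 0 = v)
    (hw : s.nat groupReg 0 = w) :
    (flagMeeting.eval s).nat flagReg 0 = 0 ↔
      s.nat flagReg 0 = 0 ∧ Disjoint (𝔊.group v) (𝔊.group w) := by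
  let P (m : ℕ) (s' : Store) : Prop := s'.nat flagReg 0 = 0 ↔
    s.nat flagReg 0 = 0 ∧ ¬∃ i : Fin N, i.val < m ∧ i ∈ 𝔊.group v ∧ i ∈ 𝔊.group w
  suffices P N (flagMeeting.eval s) by simpa [P, Finset.disjoint_left] using this
  refine eval_forLoop_induction P h.variableCount (fun _ _ _ hP => hP) (by simp [P]) ?_
  intro m hm s' hf hcount ih
  have h' := h.of_frame hf
  have hcond : (Test.and (memberTest childReg) (memberTest groupReg)).Holds s' ↔
      (⟨m, hm⟩ : Fin N) ∈ 𝔊.group v ∧ (⟨m, hm⟩ : Fin N) ∈ 𝔊.group w :=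
    and_congr (h'.holds_memberTest hcount (by rw [hf.nat (by decide), hv]))
      (h'.holds_memberTest hcount (by rw [hf.nat (by decide), hw]))
  simp only [eval, hcond, P, exists_fin_lt_add_one hm]
  split_ifs with hcommon
  · simp [hcommon]
  · simpa only [hcommon, or_false] using ih

/-- Leaves the flag down if the child is a leaf that hangs on the parent. -/
def testLeaf : ForProgram :=
  .setNat flagReg (.lit 0) (.lit 0) ;;
  .forLoop groupReg 1
    (.ite (.and (aliveTest groupReg) (.and (neTest groupReg childReg) (neTest groupReg parentReg)))
      flagMeeting .skip)

theorem eval_testLeaf (h : Ready 𝔊 G x s) (hv : s.nat childReg 0 = v)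
    (hu : s.nat parentReg 0 = u) :
    (testLeaf.eval s).nat flagReg 0 = 0 ↔
      ∀ w ∈ alive M s, w ≠ v → w ≠ u → Disjoint (𝔊.group v) (𝔊.group w) := by
  let P (m : ℕ) (s' : Store) : Prop := s'.nat flagReg 0 = 0 ↔
    ¬∃ w : Fin M, w.val < m ∧
      (w ∈ alive M s ∧ w ≠ v ∧ w ≠ u) ∧ ¬Disjoint (𝔊.group v) (𝔊.group w)
  suffices P M (testLeaf.eval s) by simpa [P] using this
  rw [testLeaf, eval_seq]
  refine eval_forLoop_induction P h.groupCount (fun _ _ _ hP => hP) (by simp [P]) ?_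
  intro m hm s' hf hcount ih
  have hf' : Frame testLeaf s s' := (frame_eval (.setNat flagReg (.lit 0) (.lit 0)) s).seq hf
  have hv' : s'.nat childReg 0 = v := by rw [hf'.nat (by decide), hv]
  have hu' : s'.nat parentReg 0 = u := by rw [hf'.nat (by decide), hu]
  have hcond : (Test.and (aliveTest groupReg)
      (.and (neTest groupReg childReg) (neTest groupReg parentReg))).Holds s' ↔
      (⟨m, hm⟩ : Fin M) ∈ alive M s ∧ ⟨m, hm⟩ ≠ v ∧ ⟨m, hm⟩ ≠ u := by
    rw [← alive_of_frame hf']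
    exact and_congr (holds_aliveTest hcount)
      (and_congr (holds_neTest hcount hv') (holds_neTest hcount hu'))
  simp only [eval, hcond, P, exists_fin_lt_add_one hm]
  split_ifs with hother
  · rw [eval_flagMeeting (w := ⟨m, hm⟩) (h.of_frame hf') hv' hcount, show _ ↔ _ from ih]
    simp only [hother, not_or, not_not, ne_eq, not_false_eq_true, and_self, true_and]
  · simpa only [hother, false_and, or_false] using ih

/-- The blocks of a root map onto the groups that are alive have their best sets in the table. -/
def Reduced (𝔊 : GroupStructure N M) (x : Fin N → ℝ) (s : Store) : Prop :=
  ∃ ρ, IsRootMap 𝔊.group (alive M s) ρ ∧ ∀ r ∈ alive M s, TableBest 𝔊 x s (block ρ r) r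

theorem Reduced.of_frame {c : ForProgram} (h : Reduced 𝔊 x s) (hf : Frame c s s')
    (hrow : rowArray ∉ c.natWrites := by exact of_decide_eq_true rfl)
    (hdead : deadArray ∉ c.natWrites := by exact of_decide_eq_true rfl) : Reduced 𝔊 x s' := by
  unfold Reduced TableBest
  rw [alive_of_frame hf hdead, row_of_frame hf hrow]
  exact h

/-- Merges the block of the child into the block of the parent for good. -/
def absorb : ForProgram :=
  merge ;; .setNat deadArray (reg childReg) (.lit 1)

theorem alive_eval_absorb (hv : s.nat childReg 0 = v) :
    alive M (absorb.eval s) = (alive M s).erase v := by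
  have hf : Frame merge s _ := frame_eval _ s
  ext l
  rw [absorb, eval_seq]
  simp only [eval, mem_alive, Finset.mem_erase, nat_setNat, NatExpr.value, true_and,
    hf.nat (a := childReg) (by decide), hf.nat (a := deadArray) (by decide), hv, Fin.val_inj]
  split_ifs <;> simp_all

theorem Reduced.eval_absorb (h : Ready 𝔊 G x s) (hs : Reduced 𝔊 x s)
    (hv : s.nat childReg 0 = v) (hu : s.nat parentReg 0 = u)
    (hvu : IsLeaf 𝔊.group (alive M s) v u) : Reduced 𝔊 x (absorb.eval s) := by
  obtain ⟨ρ, hρ, hbest⟩ := hs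
  obtain ⟨hmerged, hkept⟩ := tableBest_eval_merge h hu hv
    (hρ.meetAtRoots hvu.right_mem hvu.left_mem hvu.ne.symm)
    (hbest u hvu.right_mem) (hbest v hvu.left_mem)
  refine ⟨redirect ρ v u, by rw [alive_eval_absorb hv]; exact hρ.redirect hvu, fun r hr => ?_⟩
  rw [alive_eval_absorb hv, Finset.mem_erase] at hr
  obtain rfl | hru := eq_or_ne r u
  · rw [block_redirect_self ρ hvu.ne]
    exact hmerged
  · rw [block_redirect_of_ne ρ hr.1 hru]
    exact (hbest r hr.2).of_row_eq (hkept r hru)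

/-- Absorbs the child if it is a leaf that hangs on the parent. -/
def eliminate : ForProgram :=
  .ite (.and (aliveTest childReg) (.and (aliveTest parentReg) (neTest childReg parentReg)))
    (testLeaf ;; .ite (.natLe (reg flagReg) (.lit 0)) absorb .skip) .skip

theorem eval_eliminate (h : Ready 𝔊 G x s) (hs : Reduced 𝔊 x s) (hv : s.nat childReg 0 = v)
    (hu : s.nat parentReg 0 = u) :
    Reduced 𝔊 x (eliminate.eval s) ∧ alive M (eliminate.eval s) ⊆ alive M s ∧
      (IsLeaf 𝔊.group (alive M s) v u → alive M (eliminate.eval s) ≠ alive M s) := by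
  have hcond : (Test.and (aliveTest childReg)
      (.and (aliveTest parentReg) (neTest childReg parentReg))).Holds s ↔
      v ∈ alive M s ∧ u ∈ alive M s ∧ v ≠ u :=
    and_congr (holds_aliveTest hv) (and_congr (holds_aliveTest hu) (holds_neTest hv hu))
  have hf : Frame testLeaf s _ := frame_eval _ s
  have hleaf : (Test.natLe (reg flagReg) (.lit 0)).Holds (testLeaf.eval s) ↔
      ∀ w ∈ alive M s, w ≠ v → w ≠ u → Disjoint (𝔊.group v) (𝔊.group w) := by
    rw [← eval_testLeaf h hv hu]
    exact Nat.le_zero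
  simp only [eliminate, eval, hcond, hleaf]
  set s' := testLeaf.eval s
  have hv' : s'.nat childReg 0 = v := by rw [hf.nat (by decide), hv]
  have hu' : s'.nat parentReg 0 = u := by rw [hf.nat (by decide), hu]
  split_ifs with halive hdisj
  · have hvu : IsLeaf 𝔊.group (alive M s) v u := ⟨halive.1, halive.2.1, halive.2.2, hdisj⟩
    rw [← alive_of_frame hf] at hvu ⊢
    refine ⟨(hs.of_frame hf).eval_absorb (h.of_frame hf) hv' hu' hvu, ?_⟩
    rw [alive_eval_absorb hv']
    exact ⟨Finset.erase_subset _ _, fun _ => Finset.erase_ne_self.mpr hvu.left_mem⟩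
  · exact ⟨hs.of_frame hf, (alive_of_frame hf).subset, fun hvu => absurd hvu.disjoint hdisj⟩
  · exact ⟨hs, subset_rfl, fun hvu => absurd ⟨hvu.left_mem, hvu.right_mem, hvu.ne⟩ halive⟩

end

section

/-- A computation from `s` to `s'` eliminates roots, and at least one if some pair of groups related
by `p` consists of a leaf and the root on which it hangs. -/
structure Eliminates (𝔊 : GroupStructure N M) (x : Fin N → ℝ) (p : Fin M → Fin M → Prop)
    (s s' : Store) : Prop where
  reduced : Reduced 𝔊 x s'
  subset : alive M s' ⊆ alive M s
  alive_ne : ∀ v u, p v u → IsLeaf 𝔊.group (alive M s) v u → alive M s' ≠ alive M s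

theorem Eliminates.refl (hs : Reduced 𝔊 x s) : Eliminates 𝔊 x (fun _ _ => False) s s :=
  ⟨hs, subset_rfl, fun _ _ h => h.elim⟩

theorem Eliminates.mono {p q : Fin M → Fin M → Prop} (h : Eliminates 𝔊 x p s s')
    (hpq : ∀ v u, q v u → p v u) : Eliminates 𝔊 x q s s' :=
  ⟨h.reduced, h.subset, fun v u hq => h.alive_ne v u (hpq v u hq)⟩

theorem Eliminates.trans {p q : Fin M → Fin M → Prop} {s'' : Store} (h : Eliminates 𝔊 x p s s')
    (h' : Eliminates 𝔊 x q s' s'') : Eliminates 𝔊 x (fun v u => p v u ∨ q v u) s s'' where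
  reduced := h'.reduced
  subset := h'.subset.trans h.subset
  alive_ne v u hpq hvu heq := by
    have heq' : alive M s' = alive M s := h.subset.antisymm (heq ▸ h'.subset)
    exact hpq.elim (fun hp => h.alive_ne v u hp hvu heq')
      fun hq => h'.alive_ne v u hq (heq'.symm ▸ hvu) (heq.trans heq'.symm)

/-- Goes through the possible parents of the child. -/
def eliminateChild : ForProgram := .forLoop parentReg 1 eliminate

theorem eliminates_eval_eliminateChild (h : Ready 𝔊 G x s) (hs : Reduced 𝔊 x s) {v : Fin M}
    (hv : s.nat childReg 0 = v) :
    Eliminates 𝔊 x (fun v' _ => v' = v) s (eliminateChild.eval s) := by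
  let P (m : ℕ) (s' : Store) : Prop :=
    Eliminates 𝔊 x (fun v' u => v' = v ∧ u.val < m) s s'
  suffices P M (eliminateChild.eval s) by simpa [P] using this
  refine eval_forLoop_induction P h.groupCount (fun _ _ _ hP => ⟨hP.1, hP.2, hP.3⟩)
    ((Eliminates.refl hs).mono (by simp)) ?_
  intro m hm s' hf hcount ih
  obtain ⟨hred, hsub, hne⟩ := eval_eliminate (u := ⟨m, hm⟩) (h.of_frame hf) ih.reduced
    (by rw [hf.nat (by decide), hv]) hcount
  have hstep : Eliminates 𝔊 x (fun v' u => v' = v ∧ u = ⟨m, hm⟩) s' (eliminate.eval s') :=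
    ⟨hred, hsub, by rintro _ _ ⟨rfl, rfl⟩; exact hne⟩
  refine (Eliminates.trans ih hstep).mono fun v' u hvu => ?_
  simpa only [← and_or_left, Fin.ext_iff, ← Nat.lt_add_one_iff_lt_or_eq] using hvu

/-- Goes through all groups as children. -/
def eliminateAll : ForProgram := .forLoop childReg 1 eliminateChild

theorem eliminates_eval_eliminateAll (h : Ready 𝔊 G x s) (hs : Reduced 𝔊 x s) :
    Eliminates 𝔊 x (fun _ _ => True) s (eliminateAll.eval s) := by
  let P (m : ℕ) (s' : Store) : Prop := Eliminates 𝔊 x (fun v _ => v.val < m) s s'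
  suffices P M (eliminateAll.eval s) by simpa [P] using this
  refine eval_forLoop_induction P h.groupCount (fun _ _ _ hP => ⟨hP.1, hP.2, hP.3⟩)
    ((Eliminates.refl hs).mono (by simp)) ?_
  intro m hm s' hf hcount ih
  have hstep := eliminates_eval_eliminateChild (v := ⟨m, hm⟩) (h.of_frame hf) ih.reduced hcount
  refine (Eliminates.trans ih hstep).mono fun v _ hvu => ?_
  simpa only [Fin.ext_iff, ← Nat.lt_add_one_iff_lt_or_eq] using hvu

theorem exists_isLeaf (h𝔊 : 𝔊.groupGraph.IsAcyclic) {R : Finset (Fin M)} (hR : 1 < R.card) :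
    ∃ v u, IsLeaf 𝔊.group R v u := by
  obtain ⟨v, hv, u, hu, hvu, hleaf⟩ := exists_leaf_of_isAcyclic h𝔊 hR
  refine ⟨v, u, hv, hu, hvu, fun w hw hwv hwu => ?_⟩
  have := hleaf w hw hwv hwu
  simpa [GroupStructure.groupGraph, hwv.symm, Finset.disjoint_iff_inter_eq_empty] using this

/-- Eliminates leaves as long as there are any, which takes at most `M` rounds. -/
def reduce : ForProgram := .forLoop passReg 1 eliminateAll

theorem eval_reduce (h𝔊 : 𝔊.groupGraph.IsAcyclic) (h : Ready 𝔊 G x s) (hs : Reduced 𝔊 x s) :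
    Reduced 𝔊 x (reduce.eval s) ∧ (alive M (reduce.eval s)).card ≤ 1 := by
  let P (m : ℕ) (s' : Store) : Prop := Reduced 𝔊 x s' ∧ (alive M s').card ≤ 1 + (M - m)
  suffices P M (reduce.eval s) by simpa [P] using this
  refine eval_forLoop_induction P h.groupCount (fun _ _ _ hP => hP)
    ⟨hs, (card_finset_fin_le _).trans (by omega)⟩ ?_
  intro m hm s' hf _ ⟨hs', hcard⟩
  obtain ⟨hred, hsub, hne⟩ := eliminates_eval_eliminateAll (h.of_frame hf) hs'
  refine ⟨hred, ?_⟩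
  obtain hle | hlt := le_or_gt (alive M s').card 1
  · exact (Finset.card_le_card hsub).trans (by omega)
  · obtain ⟨v, u, hvu⟩ := exists_isLeaf h𝔊 hlt
    have := Finset.card_lt_card (hsub.ssubset_of_ne (hne v u trivial hvu))
    omega

theorem Reduced.tableBest_univ (hs : Reduced 𝔊 x s) (hcard : (alive M s).card ≤ 1) {r : Fin M}
    (hr : r ∈ alive M s) : TableBest 𝔊 x s Finset.univ r := by
  obtain ⟨ρ, hρ, hbest⟩ := hs
  have hblock : block ρ r = Finset.univ :=
    Finset.filter_true_of_mem fun a _ => Finset.card_le_one.mp hcard _ (hρ.mem a) _ hr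
  exact hblock ▸ hbest r hr

theorem Reduced.exists_mem_alive (hs : Reduced 𝔊 x s) (a : Fin M) : ∃ r, r ∈ alive M s :=
  let ⟨ρ, hρ, _⟩ := hs
  ⟨ρ a, hρ.mem a⟩

/-- The address of the row for the result. -/
abbrev bestAddr : NatExpr :=
  .add (.load squareArray (.load 0 (.lit 1))) (.load squareArray (.load 0 (.lit 1)))

/-- The row for the result, behind the rows of the table. -/
abbrev bestRow (M : ℕ) : ℕ := 2 * (M * M)

theorem Ready.value_bestAddr (h : Ready 𝔊 G x s) : bestAddr.value s = bestRow M * M := by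
  simp only [NatExpr.value, h.groupCount, h.square M le_rfl]
  ring

theorem tableRow_ne_bestRow (b : Bool) (v : Fin M) {g : ℕ} (hg : g < M) :
    tableRow M b v g ≠ bestRow M := by
  have hb : b.toNat ≤ 1 := Bool.toNat_le b
  have : (b.toNat * M + v) * M + M ≤ 2 * (M * M) := by
    calc _ = (b.toNat * M + (v + 1)) * M := by ring
      _ ≤ (1 * M + M) * M := by gcongr; exact v.2
      _ = 2 * (M * M) := by ring
  rw [tableRow, bestRow]
  omega

/-- Compares the best sets found so far with the current set of the table if that one consists of at
most `G` groups. -/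
def consider (b : Bool) : ForProgram :=
  .ite (.natLe (.add (reg sizeReg) (.lit b.toNat)) (.load 0 (.lit 2)))
    (improve bestAddr (tableAddr b childReg (reg sizeReg)) (tableAddr b childReg (reg sizeReg)))
    .skip

variable {r : Fin M} {𝒜 : Set (Finset (Fin M))}

theorem row_eval_consider (h : Ready 𝔊 G x s) (hr : s.nat childReg 0 = r) {g : ℕ}
    (hg : s.nat sizeReg 0 = g) (hgM : g < M) {b : Bool} {D : Finset (Fin M)}
    (hD : IsBest (weight 𝔊 x) (rooted D r b g) (row M s (tableRow M b r g)))
    (h𝒜 : IsBest (weight 𝔊 x) 𝒜 (row M s (bestRow M))) :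
    ∃ S, IsBest (weight 𝔊 x) (𝒜 ∪ {S | g + b.toNat ≤ G ∧ S ∈ rooted D r b g}) S ∧
      row M ((consider b).eval s) = Function.update (row M s) (bestRow M) S := by
  have hcond : (Test.natLe (.add (reg sizeReg) (.lit b.toNat)) (.load 0 (.lit 2))).Holds s ↔
      g + b.toNat ≤ G := by
    simp only [Test.Holds, NatExpr.value, hg, h.budget]
  simp only [consider, eval, hcond]
  split_ifs with hgG
  · have haddr := value_tableAddr (e := reg sizeReg) h b hr hg hgM
    refine ⟨_, ?_, row_eval_improve h h.value_bestAddr (fun _ => haddr) (fun _ _ => haddr)⟩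
    simpa only [hgG, true_and, Set.ofPred_mem_eq, Finset.union_self] using h𝒜.better hD
  · exact ⟨_, by simpa [hgG] using h𝒜, (Function.update_eq_self _ _).symm⟩

theorem row_eval_consider_consider (h : Ready 𝔊 G x s) (hr : s.nat childReg 0 = r) {g : ℕ}
    (hg : s.nat sizeReg 0 = g) (hgM : g < M) {D : Finset (Fin M)}
    (hD : ∀ b, IsBest (weight 𝔊 x) (rooted D r b g) (row M s (tableRow M b r g)))
    (h𝒜 : IsBest (weight 𝔊 x) 𝒜 (row M s (bestRow M))) :
    ∃ S, IsBest (weight 𝔊 x) (𝒜 ∪ {S | ∃ b : Bool, g + b.toNat ≤ G ∧ S ∈ rooted D r b g}) S ∧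
      row M ((consider false ;; consider true).eval s) =
        Function.update (row M s) (bestRow M) S := by
  obtain ⟨S, hS, hrow⟩ := row_eval_consider h hr hg hgM (hD false) h𝒜
  have hf : Frame (consider false) s _ := frame_eval _ s
  rw [eval_seq]
  set s' := (consider false).eval s
  obtain ⟨S', hS', hrow'⟩ := row_eval_consider (b := true) (D := D) (h.of_frame hf)
    (by rw [hf.nat (by decide), hr]) (by rw [hf.nat (by decide), hg]) hgM
    (by rw [hrow, Function.update_of_ne (tableRow_ne_bestRow true r hgM)]; exact hD true)
    (by rwa [hrow, Function.update_self])
  refine ⟨S', ?_, by rw [hrow', hrow, Function.update_idem]⟩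
  simpa only [Bool.exists_bool, Set.ofPred_or, Set.union_assoc] using hS'

/-- Goes through the sets in the table for the current group. -/
def considerAll : ForProgram := .forLoop sizeReg 1 (consider false ;; consider true)

theorem exists_mem_rooted_univ_iff {S : Finset (Fin M)} :
    (∃ g < M, ∃ b : Bool, g + b.toNat ≤ G ∧ S ∈ rooted Finset.univ r b g) ↔ S.card ≤ G := by
  constructor
  · rintro ⟨g, -, b, hg, -, hb, hS⟩
    have := Finset.pred_card_le_card_erase (s := S) (a := r)
    cases b
    · rw [Finset.erase_eq_of_notMem (by simpa using hb)] at hS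
      exact hS.trans (by simpa using hg)
    · rw [Bool.toNat_true] at hg
      omega
  · intro hS
    refine ⟨(S.erase r).card, ?_, decide (r ∈ S), ?_, Finset.subset_univ _, by simp, le_rfl⟩
    · exact (card_finset_fin_le (S.erase r)).lt_of_ne fun h => Finset.notMem_erase r S <|
        (Finset.card_eq_iff_eq_univ _).mp (h.trans (Fintype.card_fin M).symm) ▸ Finset.mem_univ r
    · by_cases hr : r ∈ S
      · rwa [decide_eq_true hr, Bool.toNat_true, Finset.card_erase_add_one hr]
      · simpa [hr, Finset.erase_eq_of_notMem hr] using hS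

theorem row_eval_considerAll (h : Ready 𝔊 G x s) (hr : s.nat childReg 0 = r)
    (hbest : TableBest 𝔊 x s Finset.univ r) (hG : (row M s (bestRow M)).card ≤ G) :
    ∃ S, IsBest (weight 𝔊 x) {S | S.card ≤ G} S ∧
      row M (considerAll.eval s) = Function.update (row M s) (bestRow M) S := by
  let 𝒞 (g : ℕ) : Set (Finset (Fin M)) :=
    {S | ∃ b : Bool, g + b.toNat ≤ G ∧ S ∈ rooted Finset.univ r b g}
  let 𝒜 (m : ℕ) : Set (Finset (Fin M)) := {row M s (bestRow M)} ∪ {S | ∃ g < m, S ∈ 𝒞 g}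
  have h𝒜 : 𝒜 M = {S | S.card ≤ G} := by
    ext S
    simp only [𝒜, 𝒞, Set.mem_ofPred_eq, exists_mem_rooted_univ_iff, Set.mem_union,
      Set.mem_singleton_iff, or_iff_right_iff_imp]
    rintro rfl
    exact hG
  have h𝒜_succ (m : ℕ) : 𝒜 m ∪ 𝒞 m = 𝒜 (m + 1) := by
    ext S
    simp only [𝒜, Set.mem_union, Set.mem_ofPred_eq, Nat.lt_add_one_iff_lt_or_eq, or_and_right,
      exists_or, exists_eq_left, or_assoc]
  let P (m : ℕ) (s' : Store) : Prop := ∃ S, IsBest (weight 𝔊 x) (𝒜 m) S ∧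
    row M s' = Function.update (row M s) (bestRow M) S
  rw [← h𝒜]
  refine eval_forLoop_induction P h.groupCount (fun _ _ _ hP => hP)
    ⟨_, by constructor <;> simp [𝒜], (Function.update_eq_self _ _).symm⟩ ?_
  rintro m hm s' hf hcount ⟨S, hS, hrow⟩
  obtain ⟨S', hS', hrow'⟩ := row_eval_consider_consider (r := r) (h.of_frame hf)
    (by rw [hf.nat (by decide), hr]) hcount hm
    (fun b => by
      rw [hrow, Function.update_of_ne (tableRow_ne_bestRow b r hm)]
      exact hbest b m hm)
    (by rwa [hrow, Function.update_self])
  exact ⟨S', h𝒜_succ m ▸ hS', by rw [hrow', hrow, Function.update_idem]⟩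

/-- Goes through the sets in the table for the remaining root. -/
def considerRoots : ForProgram :=
  .forLoop childReg 1 (.ite (aliveTest childReg) considerAll .skip)

theorem isBest_eval_considerRoots (h : Ready 𝔊 G x s) (hs : Reduced 𝔊 x s)
    (hcard : (alive M s).card ≤ 1) (hG : (row M s (bestRow M)).card ≤ G) :
    IsBest (weight 𝔊 x) {S | S.card ≤ G} (row M (considerRoots.eval s) (bestRow M)) := by
  let P (m : ℕ) (s' : Store) : Prop := ∃ S : Finset (Fin M), S.card ≤ G ∧
    ((∃ r : Fin M, r.val < m ∧ r ∈ alive M s) → IsBest (weight 𝔊 x) {S | S.card ≤ G} S) ∧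
    row M s' = Function.update (row M s) (bestRow M) S
  obtain ⟨S, hS, hbest, hrow⟩ : P M (considerRoots.eval s) := by
    refine eval_forLoop_induction P h.groupCount (fun _ _ _ hP => hP)
      ⟨_, hG, by simp, (Function.update_eq_self _ _).symm⟩ ?_
    rintro m hm s' hf hcount ⟨S, hS, hbest, hrow⟩
    have hcond : (aliveTest childReg).Holds s' ↔ (⟨m, hm⟩ : Fin M) ∈ alive M s := by
      rw [holds_aliveTest (l := ⟨m, hm⟩) hcount, alive_of_frame hf]
    simp only [eval, hcond, P, exists_fin_lt_add_one hm]
    split_ifs with halive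
    · obtain ⟨S', hS', hrow'⟩ := row_eval_considerAll (h.of_frame hf) hcount
        ((hs.tableBest_univ hcard halive).of_row_eq fun b g hg => by
          rw [hrow, Function.update_of_ne (tableRow_ne_bestRow b _ hg)])
        (by rwa [hrow, Function.update_self])
      exact ⟨S', hS'.mem, fun _ => hS', by rw [hrow', hrow, Function.update_idem]⟩
    · exact ⟨S, hS, by simpa only [halive, or_false] using hbest, hrow⟩
  rw [hrow, Function.update_self]
  obtain hM | ⟨⟨a⟩⟩ := isEmpty_or_nonempty (Fin M)
  · exact ⟨hS, fun T _ => by rw [Subsingleton.elim T S]⟩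
  · obtain ⟨r, hr⟩ := hs.exists_mem_alive a
    exact hbest ⟨r, r.2, hr⟩

/-- Empties the row for the result. -/
def clearBest : ForProgram :=
  .forLoop groupReg 1 (.setNat rowArray (.add bestAddr (reg groupReg)) (.lit 0))

theorem row_eval_clearBest (h : Ready 𝔊 G x s) :
    row M (clearBest.eval s) = Function.update (row M s) (bestRow M) ∅ := by
  let P (m : ℕ) (s' : Store) : Prop := ∀ k, ∀ l : Fin M, s'.nat rowArray (k * M + l) =
    if k = bestRow M ∧ l.val < m then 0 else s.nat rowArray (k * M + l)
  suffices hP : P M (clearBest.eval s) by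
    ext k l
    rw [mem_row, hP]
    by_cases hk : k = bestRow M <;> simp [hk, mem_row]
  refine eval_forLoop_induction P h.groupCount (fun _ _ _ hP => hP) (by simp [P]) ?_
  intro m hm s' hf hcount ih k l
  have haddr : (NatExpr.add bestAddr (reg groupReg)).value s' = bestRow M * M + m :=
    congrArg₂ (· + ·) (h.of_frame hf).value_bestAddr hcount
  rw [eval, haddr, nat_setNat, ih k l]
  simp only [mul_add_inj l.2 hm, true_and, NatExpr.value]
  by_cases hl : l.val = m
  · by_cases hk : k = bestRow M <;> simp [hk, hl]
  · simp [hl, Nat.lt_add_one_iff_lt_or_eq, -Order.lt_add_one_iff]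

/-- Finds a best set of at most `G` groups. -/
def choose : ForProgram := clearBest ;; considerRoots

theorem isBest_eval_choose (h : Ready 𝔊 G x s) (hs : Reduced 𝔊 x s)
    (hcard : (alive M s).card ≤ 1) :
    IsBest (weight 𝔊 x) {S | S.card ≤ G} (row M (choose.eval s) (bestRow M)) := by
  have hf : Frame clearBest s _ := frame_eval _ s
  have hrow := row_eval_clearBest h
  rw [choose, eval_seq]
  have halive := alive_of_frame (M := M) hf
  refine isBest_eval_considerRoots (h.of_frame hf) ?_ (halive ▸ hcard) ?_
  · obtain ⟨ρ, hρ, hbest⟩ := hs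
    refine ⟨ρ, halive ▸ hρ, fun r hr => (hbest r (halive ▸ hr)).of_row_eq fun b g hg => ?_⟩
    rw [hrow, Function.update_of_ne (tableRow_ne_bestRow b r hg)]
  · rw [hrow, Function.update_self, Finset.card_empty]
    exact Nat.zero_le G

end

section

/-- Stores the multiples of the value of `e` in the array `a`, as far as the cell `n` of the array
`0` says. -/
def multiples (a : ℕ) (n : Fin 2) (e : NatExpr) : ForProgram :=
  .forLoop groupReg n
    (.setNat a (.add (reg groupReg) (.lit 1)) (.add (.load a (reg groupReg)) e))

theorem nat_eval_multiples {a c m : ℕ} {n : Fin 2} {e : NatExpr} (ha : a ≠ groupReg)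
    (hn : s.nat 0 n = m) (h0 : s.nat a 0 = 0)
    (he : ∀ s', Frame (multiples a n e) s s' → e.value s' = c) (i : ℕ) :
    ((multiples a n e).eval s).nat a i = if i ≤ m then i * c else s.nat a i := by
  let P (j : ℕ) (s' : Store) : Prop := ∀ i, s'.nat a i = if i ≤ j then i * c else s.nat a i
  refine eval_forLoop_induction P hn (fun j s' v hP i => ?_) (fun i => ?_) ?_ i
  · rw [nat_setNat_of_ne _ _ _ ha]
    exact hP i
  · obtain rfl | hi := Nat.eq_zero_or_pos i
    · simpa using h0
    · rw [if_neg (by omega)]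
  intro j _ s' hf hcount ih i
  simp only [eval, nat_setNat, NatExpr.value, hcount, ih j, he s' hf, le_refl, if_true, true_and]
  obtain rfl | hi := eq_or_ne i (j + 1)
  · simp [add_one_mul]
  · simp [hi, ih i, Nat.le_succ_iff]

/-- Stores the multiples of `M`. -/
def setMultiple : ForProgram :=
  multiples multipleArray 0 (.load 0 (.lit 1)) ;; multiples multipleArray 1 (.load 0 (.lit 1))

theorem nat_eval_setMultiple (hN : s.nat 0 0 = N) (hM : s.nat 0 1 = M)
    (h0 : s.nat multipleArray 0 = 0) {i : ℕ} (hi : i ≤ N ∨ i ≤ M) :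
    (setMultiple.eval s).nat multipleArray i = i * M := by
  have hsize {s' : Store} (n : Fin 2) (h : s'.nat 0 1 = M) (s'' : Store)
      (hf : Frame (multiples multipleArray n (.load 0 (.lit 1))) s' s'') : s''.nat 0 1 = M :=
    (congrFun (hf.nat (of_decide_eq_true rfl)) 1).trans h
  have hf : Frame (multiples multipleArray 0 (.load 0 (.lit 1))) s _ := frame_eval _ s
  have hfirst := nat_eval_multiples (by decide) hN h0 (hsize 0 hM)
  rw [setMultiple, eval_seq, nat_eval_multiples (by decide) (hsize 0 hM _ hf) (by simp [hfirst])
    (hsize 1 (hsize 0 hM _ hf)), hfirst]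
  split_ifs <;> tauto

/-- Stores the multiples of `M * M`. -/
def setSquare : ForProgram :=
  multiples squareArray 1 (.load multipleArray (.load 0 (.lit 1)))

theorem nat_eval_setSquare (hM : s.nat 0 1 = M) (hmul : s.nat multipleArray M = M * M)
    (h0 : s.nat squareArray 0 = 0) {i : ℕ} (hi : i ≤ M) :
    (setSquare.eval s).nat squareArray i = i * (M * M) := by
  rw [setSquare, nat_eval_multiples (by decide) hM h0 (c := M * M), if_pos hi]
  intro s' hf
  simp only [NatExpr.value]
  rw [hf.nat (by decide), hf.nat (by decide), hM, hmul]

theorem nat_input_biadj (𝔊 : GroupStructure N M) (G : ℕ) (x : Fin N → ℝ) (i : Fin N) (l : Fin M) :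
    (input 𝔊 G x).nat incidenceArray (i * M + l) = if i ∈ 𝔊.group l then 1 else 0 := by
  have hk : i * M + l = (finProdFinEquiv (i, l)).val := by
    rw [finProdFinEquiv_apply_val, add_comm, mul_comm]
  have hpair := finProdFinEquiv.symm_apply_apply (i, l)
  rw [finProdFinEquiv_symm_apply, Prod.mk.injEq] at hpair
  rw [hk]
  exact (dif_pos (finProdFinEquiv (i, l)).2).trans (by
    rw [Fin.eta, hpair.1, hpair.2]
    rfl)

/-- Prepares the addressing. -/
def prepare : ForProgram := setMultiple ;; setSquare

theorem ready_eval_prepare (𝔊 : GroupStructure N M) (G : ℕ) (x : Fin N → ℝ) :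
    Ready 𝔊 G x (prepare.eval (input 𝔊 G x)) := by
  have hf : Frame prepare (input 𝔊 G x) _ := frame_eval _ _
  have hf₁ : Frame setMultiple (input 𝔊 G x) _ := frame_eval _ _
  have hf₂ : Frame setSquare (setMultiple.eval (input 𝔊 G x)) _ := frame_eval _ _
  have hmultiple {i : ℕ} := nat_eval_setMultiple (N := N) (M := M) (s := input 𝔊 G x) (i := i)
    rfl rfl rfl
  constructor
  · rw [hf.nat (by decide)]
    rfl
  · rw [hf.nat (by decide)]
    rfl
  · rw [hf.nat (by decide)]
    rfl
  · intro i l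
    rw [hf.nat (by decide), nat_input_biadj]
  · intro i
    rw [hf.real (by decide)]
    exact dif_pos i.2
  · intro i hi
    rw [prepare, eval_seq, hf₂.nat (by decide), hmultiple hi]
  · intro i hi
    refine nat_eval_setSquare ?_ (hmultiple (.inr le_rfl)) ?_ hi
    · rw [hf₁.nat (by decide)]
      rfl
    · rw [hf₁.nat (by decide)]
      rfl

theorem row_setNat_one (s : Store) (k : ℕ) (l : Fin M) :
    row M (s.setNat rowArray (k * M + l) 1) =
      Function.update (row M s) k (insert l (row M s k)) := by
  ext j l'
  simp only [mem_row, nat_setNat, mul_add_inj l'.2 l.2, true_and, Fin.val_inj,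
    Function.update_apply]
  by_cases hj : j = k <;> by_cases hl : l' = l <;> simp [hj, hl, mem_row]

variable {v : Fin M}

/-- Enters the current group as a set in the table. -/
def initGroup : ForProgram :=
  .forLoop sizeReg 1
    (.setNat rowArray (.add (tableAddr true childReg (reg sizeReg)) (reg childReg)) (.lit 1))

theorem row_eval_initGroup (h : Ready 𝔊 G x s) (hv : s.nat childReg 0 = v)
    (hempty : ∀ g < M, row M s (tableRow M true v g) = ∅) :
    ∀ b (w : Fin M), ∀ g < M, row M (initGroup.eval s) (tableRow M b w g) =
      if b = true ∧ w = v then {v} else row M s (tableRow M b w g) := by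
  let P (m : ℕ) (s' : Store) : Prop :=
    ∀ b (w : Fin M), ∀ g < M, row M s' (tableRow M b w g) =
      if (b = true ∧ w = v) ∧ g < m then {v} else row M s (tableRow M b w g)
  suffices hP : P M (initGroup.eval s) from fun b w g hg => by
    simpa only [hg, and_true] using hP b w g hg
  refine eval_forLoop_induction P h.groupCount (fun _ _ _ hP => hP) (by simp [P]) ?_
  intro m hm s' hf hcount ih b w g hg
  have hv' : s'.nat childReg 0 = v := by rw [hf.nat (by decide), hv]
  have haddr : (NatExpr.add (tableAddr true childReg (reg sizeReg)) (reg childReg)).value s' =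
      tableRow M true v m * M + v :=
    congrArg₂ (· + ·) (value_tableAddr (h.of_frame hf) true hv' hcount hm) hv'
  have hnew : row M s' (tableRow M true v m) = ∅ := by
    rw [ih true v m hm, if_neg (by simp), hempty m hm]
  rw [eval, haddr, NatExpr.value, row_setNat_one, hnew, insert_empty_eq, Function.update_apply,
    ih b w g hg]
  simp only [tableRow_inj hg hm]
  by_cases hbw : b = true ∧ w = v <;> by_cases hgm : g = m <;>
    simp [hbw, hgm, Nat.lt_add_one_iff_lt_or_eq, -Order.lt_add_one_iff]

/-- Fills the table for the blocks of a single group each. -/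
def initTable : ForProgram := .forLoop childReg 1 initGroup

theorem row_eval_initTable (h : Ready 𝔊 G x s) (hempty : ∀ k, row M s k = ∅) :
    ∀ b (v : Fin M), ∀ g < M, row M (initTable.eval s) (tableRow M b v g) =
      if b = true then {v} else ∅ := by
  let P (m : ℕ) (s' : Store) : Prop :=
    ∀ b (v : Fin M), ∀ g < M, row M s' (tableRow M b v g) =
      if b = true ∧ v.val < m then {v} else ∅
  suffices P M (initTable.eval s) by simpa [P] using this
  refine eval_forLoop_induction P h.groupCount (fun _ _ _ hP => hP) (by simp [P, hempty]) ?_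
  intro m hm s' hf hcount ih b v g hg
  rw [row_eval_initGroup (v := ⟨m, hm⟩) (h.of_frame hf) hcount
    (fun g hg => by rw [ih true _ g hg, if_neg (by simp)]) b v g hg, ih b v g hg]
  by_cases hv : v = ⟨m, hm⟩
  · cases b <;> simp [hv]
  · have : v.val ≠ m := fun h => hv (Fin.ext h)
    simp [hv, this, Nat.lt_add_one_iff_lt_or_eq, -Order.lt_add_one_iff]

theorem reduced_eval_initTable (h : Ready 𝔊 G x s) (hempty : ∀ k, row M s k = ∅)
    (halive : alive M s = Finset.univ) : Reduced 𝔊 x (initTable.eval s) := by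
  have hf : Frame initTable s _ := frame_eval _ s
  rw [← alive_of_frame hf] at halive
  refine ⟨id, halive ▸ isRootMap_id _, fun r _ b g hg => ?_⟩
  have hblock : block id r = {r} := by simp [block, Finset.filter_eq']
  rw [row_eval_initTable h hempty b r g hg, hblock]
  exact ⟨mem_rooted_singleton.mpr rfl, fun T hT => by rw [mem_rooted_singleton.mp hT]⟩

/-- Writes the vector `ω` of the output for the set in the row for the result. -/
def emitGroups : ForProgram :=
  .forLoop groupReg 1 (.setNat selectionArray (reg groupReg)
    (.sub (.lit 1) (.sub (.lit 1) (.load rowArray (.add bestAddr (reg groupReg))))))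

theorem eval_emitGroups (h : Ready 𝔊 G x s) (l : Fin M) :
    (emitGroups.eval s).nat selectionArray l = if l ∈ row M s (bestRow M) then 1 else 0 := by
  let P (m : ℕ) (s' : Store) : Prop := ∀ l : Fin M, l.val < m →
    s'.nat selectionArray l = if l ∈ row M s (bestRow M) then 1 else 0
  suffices P M (emitGroups.eval s) from this l l.2
  refine eval_forLoop_induction P h.groupCount (fun _ _ _ hP => hP) (by simp [P]) ?_
  intro m _ s' hf hcount ih l hl
  have haddr : (NatExpr.add bestAddr (reg groupReg)).value s' = bestRow M * M + m :=
    congrArg₂ (· + ·) (h.of_frame hf).value_bestAddr hcount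
  rw [← row_of_frame hf, eval, nat_setNat]
  obtain hlm | hlm := eq_or_ne l.val m
  · rw [if_pos ⟨rfl, hlm.trans hcount.symm⟩]
    change 1 - (1 - s'.nat rowArray ((NatExpr.add bestAddr (reg groupReg)).value s')) = _
    rw [haddr, ← hlm]
    simp only [mem_row]
    split_ifs <;> omega
  · rw [if_neg fun hlm' => hlm (hlm'.2.trans hcount)]
    exact (row_of_frame (M := M) hf).symm ▸ ih l (by omega)

/-- Writes the vector `y` of the output for the set in the row for the result. -/
def emitVariables : ForProgram :=
  .setNat targetReg (.lit 0) bestAddr ;; weigh targetReg targetReg candidateReg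

theorem eval_emitVariables (h : Ready 𝔊 G x s) (i : Fin N) :
    (emitVariables.eval s).nat coveredArray i =
      if i ∈ (row M s (bestRow M)).biUnion 𝔊.group then 1 else 0 := by
  have hf : Frame (.setNat targetReg (.lit 0) bestAddr) s _ := frame_eval _ s
  have htarget : (s.setNat targetReg 0 (bestAddr.value s)).nat targetReg 0 = bestRow M * M := by
    simp only [nat_setNat, and_self, if_true, h.value_bestAddr]
  rw [emitVariables, eval_seq]
  have hcover := (eval_weigh (r := candidateReg) (h.of_frame hf) htarget (by decide) htarget
    (by decide) (by decide)).2 i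
  rwa [Finset.union_self, row_of_frame hf] at hcover

theorem objective_le_weight {ω : Fin M → ℕ} {y : Fin N → ℕ} (hF : Feasible 𝔊 G ω y) :
    objective x y ≤ weight 𝔊 x (Finset.univ.filter fun l => ω l = 1) := by
  obtain ⟨hω, hy, hcov, -⟩ := hF
  unfold objective weight coverage
  rw [← Finset.univ_inter (Finset.biUnion _ _), ← Finset.sum_ite_mem]
  refine Finset.sum_le_sum fun i _ => ?_
  obtain h0 | h1 := hy i
  · rw [h0]
    split_ifs <;> simp [sq_nonneg]
  · have hpos : 0 < 𝔊.biadj.mulVec ω i := (Nat.lt_of_lt_of_eq one_pos h1.symm).trans_le (hcov i)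
    obtain ⟨l, -, hl⟩ := Finset.exists_ne_zero_of_sum_ne_zero
      (show ∑ k, 𝔊.biadj i k * ω k ≠ 0 from hpos.ne')
    have hil : i ∈ 𝔊.group l := by
      by_contra hil
      simp [GroupStructure.biadj, hil] at hl
    have hωl : ω l = 1 := (hω l).resolve_left fun h => hl (by rw [h, mul_zero])
    rw [if_pos (Finset.mem_biUnion.mpr ⟨l, by simpa using hωl, hil⟩), h1, Nat.cast_one, one_mul]

theorem Feasible.card_le {ω : Fin M → ℕ} {y : Fin N → ℕ} (hF : Feasible 𝔊 G ω y) :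
    (Finset.univ.filter fun l => ω l = 1).card ≤ G := by
  rw [Finset.card_filter]
  refine (Finset.sum_le_sum fun l _ => ?_).trans hF.2.2.2
  split_ifs <;> omega

variable {S : Finset (Fin M)}

theorem feasible_indicators (hS : S.card ≤ G) : Feasible 𝔊 G (fun l => if l ∈ S then 1 else 0)
    (fun i => if i ∈ S.biUnion 𝔊.group then 1 else 0) := by
  refine ⟨fun l => ?_, fun i => ?_, fun i => ?_, ?_⟩
  · exact (ite_eq_or_eq _ _ _).symm
  · exact (ite_eq_or_eq _ _ _).symm
  · beta_reduce
    split_ifs with hi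
    · obtain ⟨l, hl, hil⟩ := Finset.mem_biUnion.mp hi
      refine le_trans ?_ (Finset.single_le_sum (f := fun k => 𝔊.biadj i k * if k ∈ S then 1 else 0)
        (fun _ _ => Nat.zero_le _) (Finset.mem_univ l))
      simp [GroupStructure.biadj, hil, hl]
    · exact Nat.zero_le _
  · simpa using hS

theorem isSolution_of_isBest (hS : IsBest (weight 𝔊 x) {S | S.card ≤ G} S) :
    IsSolution 𝔊 G x (fun l => if l ∈ S then 1 else 0)
      (fun i => if i ∈ S.biUnion 𝔊.group then 1 else 0) := by
  refine ⟨feasible_indicators hS.mem, fun ω y hF => ?_⟩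
  have hobj : objective x (fun i => if i ∈ S.biUnion 𝔊.group then 1 else 0) = weight 𝔊 x S := by
    simp only [objective, coverage, Nat.cast_ite, Nat.cast_one, Nat.cast_zero, ite_mul, one_mul,
      zero_mul, Finset.sum_ite_mem, Finset.univ_inter]
  exact hobj ▸ (objective_le_weight hF).trans (hS.le _ hF.card_le)

/-- Solves the weighted maximum coverage problem by the elimination of leaves. -/
def algorithm : ForProgram :=
  prepare ;; initTable ;; reduce ;; choose ;; emitGroups ;; emitVariables

theorem isSolution_eval_algorithm (h𝔊 : 𝔊.groupGraph.IsAcyclic) (G : ℕ) (x : Fin N → ℝ) :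
    IsSolution 𝔊 G x (outputGroups M (algorithm.eval (input 𝔊 G x)))
      (outputVariables N (algorithm.eval (input 𝔊 G x))) := by
  have hready := ready_eval_prepare 𝔊 G x
  have hf : Frame prepare (input 𝔊 G x) _ := frame_eval _ _
  simp only [algorithm, eval_seq]
  set s₁ := prepare.eval (input 𝔊 G x)
  have hempty (k : ℕ) : row M s₁ k = ∅ := by
    rw [row_of_frame hf]
    exact Finset.filter_false_of_mem fun l _ => not_not.mpr rfl
  have halive : alive M s₁ = Finset.univ := by
    rw [alive_of_frame hf]
    exact Finset.filter_true_of_mem fun l _ => rfl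
  have hinit := reduced_eval_initTable hready hempty halive
  replace hready := hready.of_frame (frame_eval initTable _)
  obtain ⟨hred, hcard⟩ := eval_reduce h𝔊 hready hinit
  replace hready := hready.of_frame (frame_eval reduce _)
  have hbest := isBest_eval_choose hready hred hcard
  replace hready := hready.of_frame (frame_eval choose _)
  set s₄ := choose.eval (reduce.eval (initTable.eval s₁))
  have hf' : Frame emitGroups s₄ _ := frame_eval _ _
  convert isSolution_of_isBest hbest using 1
  · funext l
    rw [← eval_emitGroups hready l]
    exact congrFun ((frame_eval emitVariables _).nat (by decide)) l
  · funext i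
    rw [← row_of_frame hf']
    exact eval_emitVariables (hready.of_frame hf') i

end

end WMC

theorem proposition2 :
    ∃ (P : RealRAM.Program) (p : Polynomial ℕ),
      ∀ (N M : ℕ) (𝔊 : GroupStructure N M), 𝔊.LooplessPairwiseOverlapping →
        ∀ (G : ℕ) (x : Fin N → ℝ),
          ∃ (s : RealRAM.Store) (t : ℕ),
            RealRAM.Runs P (WMC.input 𝔊 G x) s t ∧
            t ≤ p.eval (N + M) ∧
            WMC.IsSolution 𝔊 G x (WMC.outputGroups M s) (WMC.outputVariables N s) := by
  refine ⟨WMC.algorithm.compile, WMC.algorithm.timeBound, fun N M 𝔊 h𝔊 G x => ?_⟩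
  have hsizes (n : Fin 2) : (WMC.input 𝔊 G x).nat 0 n ≤ N + M := by
    fin_cases n
    · exact Nat.le_add_right N M
    · exact Nat.le_add_left M N
  obtain ⟨t, ht, hruns⟩ := RealRAM.ForProgram.runs_compile WMC.algorithm (WMC.input 𝔊 G x)
    (of_decide_eq_true rfl) (by decide) hsizes
  exact ⟨_, t, hruns, ht, WMC.isSolution_eval_algorithm h𝔊.2 G x⟩
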